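/- Let $(a_n)_{n\ge 0}$ and $(b_n)_{n\ge 0}$ be real sequences with $a_n>0$ for all $n$. Let $(p_n)_{n\ge 0}$ be the associated orthonormal polynomials, \[ p_0(x)=1,\qquad p_1(x)=\frac{x-b_0}{a_0},\qquad a_n p_{n+1}(x)=(x-b_n)p_n(x)-a_{n-1}p_{n-1}(x)\quad (n\ge 1). \] Let $N$ and $r$ be positive integers and $i\in\{0,1,\dots,N-1\}$. For $n\ge 1$ and $x\in\mathbb R$ put \[ B_n(x)=\begin{pmatrix}0&1\\ -\frac{a_{n-1}}{a_n}&\frac{x-b_n}{a_n}\end{pmatrix},\qquad X_n(x)=B_{n+N-1}(x)\cdots B_{n+1}(x)B_n(x), \] \[ \operatorname{discr}X=(\operatorname{tr}X)^2-4\det X,\qquad \lambda_n(x)=\tfrac12\operatorname{tr}X_n(x)+\tfrac{\mathrm i}{2}\sqrt{|\operatorname{discr}X_n(x)|}, \] where $\mathrm i$ is the imaginary unit. Let $K$ be a compact subset of \[ \Lambda=\Big\{x\in\mathbb R:\ \lim_{k\to\infty}\operatorname{discr}\big(X_{kN+i}(x)\big)\text{ exists and is negative}\Big\}. \] Assume that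 \[ \lim_{k\to\infty}\frac{a_{(k+1)N+i-1}}{a_{kN+i-1}}=1 \] and that the sequence $(Y_k)_{k\ge 1}$, $Y_k=X_{kN+i}|_K$, belongs to the Stolz class $\mathcal D_{r,0}\big(K,\mathrm{GL}(2,\mathbb R)\big)$. This means that $\sup_{k\ge 1}\sup_{x\in K}\|Y_k(x)\|<\infty$ and, for every $j\in\{1,\dots,r\}$, \[ \sum_{k\ge 1}\Big(\sup_{x\in K}\big\|\Delta^jY_k(x)\big\|\Big)^{r/j}<\infty , \] where $\Delta^0Y_k=Y_k$ and $\Delta^jY_k=\Delta^{j-1}Y_{k+1}-\Delta^{j-1}Y_k$. Then there are continuous functions $t_j:K\to\mathbb C$ ($j\ge 1$) and $\varphi:K\to\mathbb C$ such that \[ \inf_{j\ge 1}\inf_{x\in K}|t_j(x)|>0, \] \[ \lim_{k\to\infty}\sup_{x\in K}\bigg|\Big(p_{(k+1)N+i}(x)-\overline{\lambda_{kN+i}(x)}\,p_{kN+i}(x)\Big)\prod_{j=1}^k\frac1{t_j(x)}-\varphi(x)\bigg|=0, \] and \[ \lim_{j\to\infty}\sup_{x\in K}\big|t_j(x)-\lambda_{jN+i}(x)\big|=0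 . \] -/

import Mathlib

open Filter Topology
open scoped Matrix.Norms.L2Operator

namespace JacobiStolz

/-- The sequence `(x_n : n ≥ 1)` in a normed space belongs to the Stolz class `D_{r,s}`: it is
bounded, and for every `j ∈ {1, ..., r - s}` one has `∑_{n ≥ 1} ‖Δ^j x_n‖ ^ (r / (j + s)) < ∞`.
The term `x 0` plays no role. -/
def StolzClass {E : Type*} [NormedAddCommGroup E] (r s : ℕ) (x : ℕ → E) : Prop :=
  (∃ c : ℝ, ∀ n : ℕ, 1 ≤ n → ‖x n‖ ≤ c) ∧
  ∀ j : ℕ, 1 ≤ j → j + s ≤ r →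
    Summable fun n : ℕ => ‖(fwdDiff 1)^[j] x (n + 1)‖ ^ ((r : ℝ) / ((j + s : ℕ) : ℝ))

/-- The one-step transfer matrix `B_n(x)` of the Jacobi parameters `a`, `b`; it is meant for
`n ≥ 1`. -/
noncomputable def transfer (a b : ℕ → ℝ) (n : ℕ) (x : ℝ) : Matrix (Fin 2) (Fin 2) ℝ :=
  !![0, 1; -(a (n - 1) / a n), (x - b n) / a n]

/-- The `N`-step transfer matrix `X_n(x) = B_{n+N-1}(x) ⋯ B_{n+1}(x) B_n(x)`. -/
noncomputable def transferProd (a b : ℕ → ℝ) : ℕ → ℕ → ℝ → Matrix (Fin 2) (Fin 2) ℝ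
  | 0, _, _ => 1
  | N + 1, n, x => transfer a b (n + N) x * transferProd a b N n x

/-- The orthonormal polynomials: `p_0(x) = 1`, `p_1(x) = (x - b_0) / a_0` and
`a_n p_{n+1}(x) = (x - b_n) p_n(x) - a_{n-1} p_{n-1}(x)` for `n ≥ 1`. -/
noncomputable def orthoPoly (a b : ℕ → ℝ) : ℕ → ℝ → ℝ
  | 0, _ => 1
  | 1, x => (x - b 0) / a 0
  | n + 2, x =>
      ((x - b (n + 1)) * orthoPoly a b (n + 1) x - a n * orthoPoly a b n x) / a (n + 1)

/-- The discriminant `(tr X)² - 4 det X` of a `2 × 2` matrix. -/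
noncomputable def discr (X : Matrix (Fin 2) (Fin 2) ℝ) : ℝ := X.trace ^ 2 - 4 * X.det

/-- `Λ`: the set of all `x` for which `lim_k discr (X_{kN+i}(x))` exists and is negative. -/
def ellipticSet (a b : ℕ → ℝ) (N i : ℕ) : Set ℝ :=
  {x | ∃ l : ℝ, l < 0 ∧
    Tendsto (fun k : ℕ => discr (transferProd a b N (k * N + i) x)) atTop (𝓝 l)}

/-- `λ_n(x) = tr X_n(x) / 2 + (i / 2) √|discr X_n(x)|`. -/
noncomputable def eigen (a b : ℕ → ℝ) (N n : ℕ) (x : ℝ) : ℂ :=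
  ((transferProd a b N n x).trace : ℂ) / 2
    + Complex.I / 2 * (Real.sqrt |discr (transferProd a b N n x)| : ℂ)

theorem continuous_transferProd (a b : ℕ → ℝ) (N n : ℕ) :
    Continuous (transferProd a b N n) := by
  induction N with
  | zero => exact continuous_const
  | succ N ih =>
    have h : Continuous (transfer a b (n + N)) := by
      refine continuous_matrix fun p q => ?_
      fin_cases p <;> fin_cases q <;> simp [transfer] <;> fun_prop
    exact h.matrix_mul ih

/-- `X_n` as an element of the space of continuous matrix-valued maps on `K`, which for compact `K`
carries the supremum norm. -/
noncomputable def transferProdOn (a b : ℕ → ℝ) (N : ℕ) (K : Set ℝ) (n : ℕ) :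
    C(K, Matrix (Fin 2) (Fin 2) ℝ) :=
  ⟨fun x => transferProd a b N n x, (continuous_transferProd a b N n).comp continuous_subtype_val⟩

/-- For positive `a` and `n ≥ 1`, the matrices `X_n(x)` are invertible, so that the maps
`transferProdOn a b N K n` automatically take values in `GL(2, ℝ)`. -/
theorem isUnit_transferProd (a b : ℕ → ℝ) (ha : ∀ n, 0 < a n) (N n : ℕ) (x : ℝ) :
    IsUnit (transferProd a b N n x) := by
  induction N with
  | zero => exact isUnit_one
  | succ N ih =>
    refine IsUnit.mul ?_ ih
    rw [Matrix.isUnit_iff_isUnit_det, transfer, Matrix.det_fin_two_of, isUnit_iff_ne_zero]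
    have h₁ := ha (n + N - 1)
    have h₂ := ha (n + N)
    have h₃ := div_pos h₁ h₂
    linarith

end JacobiStolz

/-! With n = kN + i, write the real vector (p_{n-1}, p_n) as z_k (e_k, 1) plus its complex
conjugate, where (e_k, 1) is an eigenvector of X_n for λ_n. Then p_{n+N} - conj(λ_n) p_n = (λ_n -
conj λ_n) z_k (`sub_star_mul_eigenCoord`), so everything reduces to the complex scalar z_k, which
satisfies z_{k+1} = α_k z_k + β_k conj(z_k) (`eigenCoord_step`). Both α_k - λ_n and β_k have the
size of e_{k+1} - e_k: they tend to 0, but β is guaranteed to be summable only when r = 1.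

If β is summable, z_k divided by the product of the α_j converges to a function without zeros
(`exists_multipliers_of_summable`). Otherwise the substitution y = z + c conj(z) with c = β / (α -
conj α) produces a recurrence of the same shape, whose antilinear coefficient comes from Δc and from
a cubic term in c and β. Each substitution spends one difference and gains one order of decay, and
changes α only by o(1); after r - 1 of them β is dominated by the r-th power of an ℓ^r sequence
(`exists_multipliers`). The predicate `IsSymbol` does the bookkeeping: it is stable under sums,
products, inverses and square roots, hence passes from the entries of X_n to λ_n, e_k, α_k and β_k.

Uniformity on K comes from the entries of X_n being polynomials in x of degree at most N, so that
pointwise limits are uniform. The discriminants are thus eventually bounded away from 0, and λ_n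
converges uniformly to some L, with |L| = 1 because det X_n tends to 1. -/

namespace JacobiStolz

/-! ### Calculus of sequences with decaying differences. -/

section Symbols

variable {K : Type*}

/-- `f` is dominated, uniformly on `K`, by the `m`-th power of an `ℓ^r` sequence. -/
def Decays (r m : ℕ) (f : ℕ → K → ℂ) : Prop :=
  ∃ (C : ℝ) (w : ℕ → ℝ), 0 ≤ C ∧ (∀ k, 0 ≤ w k) ∧ (Summable fun k => w k ^ r) ∧
    ∀ᶠ k in atTop, ∀ x, ‖f k x‖ ≤ C * w k ^ m

theorem summable_add_pow {r : ℕ} {v w : ℕ → ℝ} (hv : ∀ k, 0 ≤ v k) (hw : ∀ k, 0 ≤ w k)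
    (hv' : Summable fun k => v k ^ r) (hw' : Summable fun k => w k ^ r) :
    Summable fun k => (v k + w k) ^ r :=
  Summable.of_nonneg_of_le (fun k => pow_nonneg (add_nonneg (hv k) (hw k)) r)
    (fun k => add_pow_le (hv k) (hw k) r) ((hv'.add hw').mul_left _)

/-- The sum of two ℓ^r weights is an ℓ^r weight dominating both, so products can be estimated with
one weight. -/
theorem Decays.common {r m m' : ℕ} {f g : ℕ → K → ℂ} (hf : Decays r m f) (hg : Decays r m' g) :
    ∃ (C : ℝ) (w : ℕ → ℝ), 0 ≤ C ∧ (∀ k, 0 ≤ w k) ∧ (Summable fun k => w k ^ r) ∧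
      ∀ᶠ k in atTop, ∀ x, ‖f k x‖ ≤ C * w k ^ m ∧ ‖g k x‖ ≤ C * w k ^ m' := by
  obtain ⟨C, v, hC, hv, hv', h⟩ := hf
  obtain ⟨D, w, hD, hw, hw', h'⟩ := hg
  refine ⟨C + D, fun k => v k + w k, by positivity, fun k => add_nonneg (hv k) (hw k),
    summable_add_pow hv hw hv' hw', ?_⟩
  filter_upwards [h, h'] with k hk hk' x
  have h₁ := hv k
  have h₂ := hw k
  refine ⟨(hk x).trans ?_, (hk' x).trans ?_⟩
  · gcongr <;> linarith
  · gcongr <;> linarith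

theorem Decays.congr {r m : ℕ} {f g : ℕ → K → ℂ} (hf : Decays r m f)
    (h : ∀ᶠ k in atTop, f k = g k) : Decays r m g := by
  obtain ⟨C, v, hC, hv, hv', h'⟩ := hf
  refine ⟨C, v, hC, hv, hv', ?_⟩
  filter_upwards [h, h'] with k hk hk' x
  rw [← hk]
  exact hk' x

theorem Decays.add {r m : ℕ} {f g : ℕ → K → ℂ} (hf : Decays r m f) (hg : Decays r m g) :
    Decays r m (f + g) := by
  obtain ⟨C, w, hC, hw, hw', h⟩ := hf.common hg
  refine ⟨C + C, w, by positivity, hw, hw', ?_⟩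
  filter_upwards [h] with k hk x
  refine (norm_add_le _ _).trans ?_
  rw [add_mul]
  exact add_le_add (hk x).1 (hk x).2

theorem Decays.mul {r m m' : ℕ} {f g : ℕ → K → ℂ} (hf : Decays r m f) (hg : Decays r m' g) :
    Decays r (m + m') (f * g) := by
  obtain ⟨C, w, hC, hw, hw', h⟩ := hf.common hg
  refine ⟨C * C, w, by positivity, hw, hw', ?_⟩
  filter_upwards [h] with k hk x
  rw [Pi.mul_apply, Pi.mul_apply, norm_mul, pow_add, mul_mul_mul_comm]
  have := hw k
  exact mul_le_mul (hk x).1 (hk x).2 (norm_nonneg _) (by positivity)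

theorem Decays.of_norm_le {r m : ℕ} {f g : ℕ → K → ℂ} (hf : Decays r m f) {c : ℝ}
    (h : ∀ᶠ k in atTop, ∀ x, ‖g k x‖ ≤ c * ‖f k x‖) : Decays r m g := by
  obtain ⟨C, w, hC, hw, hw', h'⟩ := hf
  refine ⟨|c| * C, w, by positivity, hw, hw', ?_⟩
  filter_upwards [h, h'] with k hk hk' x
  calc ‖g k x‖ ≤ c * ‖f k x‖ := hk x
    _ ≤ |c| * ‖f k x‖ := by gcongr; exact le_abs_self c
    _ ≤ |c| * (C * w k ^ m) := by gcongr; exact hk' x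
    _ = _ := by ring

theorem Decays.neg {r m : ℕ} {f : ℕ → K → ℂ} (hf : Decays r m f) : Decays r m (-f) :=
  hf.of_norm_le (c := 1) (Eventually.of_forall fun k x => by simp)

theorem Decays.shift {r m : ℕ} {f : ℕ → K → ℂ} (hf : Decays r m f) :
    Decays r m (fun k => f (k + 1)) := by
  obtain ⟨C, w, hC, hw, hw', h⟩ := hf
  exact ⟨C, fun k => w (k + 1), hC, fun k => hw _,
    (summable_nat_add_iff (f := fun k => w k ^ r) 1).2 hw', (tendsto_add_atTop_nat 1).eventually h⟩

theorem tendsto_zero_of_summable_pow {r : ℕ} {w : ℕ → ℝ} (hw : ∀ k, 0 ≤ w k)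
    (h : Summable fun k => w k ^ r) : Tendsto w atTop (𝓝 0) := by
  rw [Metric.tendsto_nhds]
  intro ε hε
  filter_upwards [h.tendsto_atTop_zero.eventually_lt_const (pow_pos hε r)] with k hk
  rw [Real.dist_0_eq_abs, abs_of_nonneg (hw k)]
  exact lt_of_pow_lt_pow_left₀ r hε.le hk

theorem Decays.mono {r m m' : ℕ} {f : ℕ → K → ℂ} (hf : Decays r m f) (h : m' ≤ m) :
    Decays r m' f := by
  obtain ⟨C, w, hC, hw, hw', hk⟩ := hf
  refine ⟨C, w, hC, hw, hw', ?_⟩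
  filter_upwards [hk, (tendsto_zero_of_summable_pow hw hw').eventually_le_const one_pos]
    with k hk hk' x
  refine (hk x).trans ?_
  gcongr 1
  exact pow_le_pow_of_le_one (hw k) hk' h

theorem decays_zero_iff {r : ℕ} (hr : r ≠ 0) {f : ℕ → K → ℂ} :
    Decays r 0 f ↔ ∃ C : ℝ, ∀ᶠ k in atTop, ∀ x, ‖f k x‖ ≤ C := by
  constructor
  · rintro ⟨C, w, -, -, -, h⟩
    exact ⟨C, by simpa using h⟩
  · rintro ⟨C, h⟩
    -- The zero weight suffices because `0 ^ 0 = 1`; `r ≠ 0` is what makes `0 ^ r` summable.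
    refine ⟨|C|, 0, abs_nonneg C, fun _ => le_rfl, by simp [hr], ?_⟩
    filter_upwards [h] with k hk x
    simpa using (hk x).trans (le_abs_self C)

theorem Decays.eventually_le {r m : ℕ} {f : ℕ → K → ℂ} (hm : m ≠ 0)
    (hf : Decays r m f) {ε : ℝ} (hε : 0 < ε) : ∀ᶠ k in atTop, ∀ x, ‖f k x‖ ≤ ε := by
  obtain ⟨C, w, hC, hw, hw', h⟩ := hf
  have h₀ : Tendsto (fun k => C * w k ^ m) atTop (𝓝 0) := by
    simpa [hm] using ((tendsto_zero_of_summable_pow hw hw').pow m).const_mul C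
  filter_upwards [h, h₀.eventually_le_const hε] with k hk hk' x
  exact (hk x).trans hk'

theorem Decays.tendstoUniformly {r m : ℕ} {f : ℕ → K → ℂ} (hm : m ≠ 0)
    (hf : Decays r m f) : TendstoUniformly f (fun _ => 0) atTop := by
  rw [Metric.tendstoUniformly_iff]
  intro ε hε
  filter_upwards [hf.eventually_le hm (half_pos hε)] with k hk x
  rw [dist_zero_left]
  linarith [hk x]

theorem Decays.inv {r : ℕ} (hr : r ≠ 0) {f : ℕ → K → ℂ} {δ : ℝ} (hδ : 0 < δ)
    (h : ∀ᶠ k in atTop, ∀ x, δ ≤ ‖f k x‖) : Decays r 0 f⁻¹ := by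
  refine (decays_zero_iff hr).2 ⟨δ⁻¹, ?_⟩
  filter_upwards [h] with k hk x
  simpa using inv_anti₀ hδ (hk x)

/-- A sequence of functions whose `j`-th differences, `j ≤ d`, decay with order `s + j`. -/
def IsSymbol (r : ℕ) : ℕ → ℕ → (ℕ → K → ℂ) → Prop
  | 0, s, f => Decays r s f
  | d + 1, s, f => Decays r s f ∧ IsSymbol r d (s + 1) (fwdDiff 1 f)

theorem fwdDiff_one_apply (f : ℕ → K → ℂ) (k : ℕ) : fwdDiff 1 f k = f (k + 1) - f k := rfl

theorem IsSymbol.decays {r d s : ℕ} {f : ℕ → K → ℂ} (hf : IsSymbol r d s f) : Decays r s f := by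
  cases d with
  | zero => exact hf
  | succ d => exact hf.1

theorem IsSymbol.lower {r d s : ℕ} {f : ℕ → K → ℂ} (hf : IsSymbol r (d + 1) s f) :
    IsSymbol r d s f := by
  induction d generalizing s f with
  | zero => exact hf.1
  | succ d ih => exact ⟨hf.1, ih hf.2⟩

theorem IsSymbol.mono {r d s s' : ℕ} {f : ℕ → K → ℂ} (hf : IsSymbol r d s f)
    (h : s' ≤ s) : IsSymbol r d s' f := by
  induction d generalizing s s' f with
  | zero => exact Decays.mono hf h
  | succ d ih => exact ⟨hf.1.mono h, ih hf.2 (by omega)⟩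

theorem IsSymbol.congr {r d s : ℕ} {f g : ℕ → K → ℂ} (hf : IsSymbol r d s f)
    (h : ∀ᶠ k in atTop, f k = g k) : IsSymbol r d s g := by
  induction d generalizing s f g with
  | zero => exact Decays.congr hf h
  | succ d ih =>
    refine ⟨hf.1.congr h, ih hf.2 ?_⟩
    filter_upwards [h, (tendsto_add_atTop_nat 1).eventually h] with k hk hk'
    rw [fwdDiff_one_apply, fwdDiff_one_apply, hk, hk']

theorem IsSymbol.add {r d s : ℕ} {f g : ℕ → K → ℂ} (hf : IsSymbol r d s f)
    (hg : IsSymbol r d s g) : IsSymbol r d s (f + g) := by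
  induction d generalizing s f g with
  | zero => exact Decays.add hf hg
  | succ d ih =>
    refine ⟨hf.1.add hg.1, ?_⟩
    rw [fwdDiff_add]
    exact ih hf.2 hg.2

theorem IsSymbol.neg {r d s : ℕ} {f : ℕ → K → ℂ} (hf : IsSymbol r d s f) :
    IsSymbol r d s (-f) := by
  induction d generalizing s f with
  | zero => exact Decays.neg hf
  | succ d ih =>
    refine ⟨hf.1.neg, (ih hf.2).congr (Eventually.of_forall fun k => ?_)⟩
    simp only [Pi.neg_apply, fwdDiff_one_apply]
    abel

theorem IsSymbol.sub {r d s : ℕ} {f g : ℕ → K → ℂ} (hf : IsSymbol r d s f)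
    (hg : IsSymbol r d s g) : IsSymbol r d s (f - g) := by
  rw [sub_eq_add_neg]
  exact hf.add hg.neg

theorem IsSymbol.shift {r d s : ℕ} {f : ℕ → K → ℂ} (hf : IsSymbol r d s f) :
    IsSymbol r d s (fun k => f (k + 1)) := by
  induction d generalizing s f with
  | zero => exact Decays.shift hf
  | succ d ih => exact ⟨hf.1.shift, ih hf.2⟩

theorem IsSymbol.conj {r d s : ℕ} {f : ℕ → K → ℂ} (hf : IsSymbol r d s f) :
    IsSymbol r d s (star f) := by
  have h {m : ℕ} {g : ℕ → K → ℂ} (hg : Decays r m g) : Decays r m (star g) :=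
    hg.of_norm_le (c := 1) (Eventually.of_forall fun k x => by simp)
  induction d generalizing s f with
  | zero => exact h hf
  | succ d ih =>
    refine ⟨h hf.1, (ih hf.2).congr (Eventually.of_forall fun k => ?_)⟩
    simp only [Pi.star_apply, fwdDiff_one_apply, star_sub]

/-- Discrete Leibniz rule: Δ(fg) = Δf · g_{k+1} + f · Δg, with one total order in both terms. -/
theorem IsSymbol.mul {r d s s' : ℕ} {f g : ℕ → K → ℂ} (hf : IsSymbol r d s f)
    (hg : IsSymbol r d s' g) : IsSymbol r d (s + s') (f * g) := by
  induction d generalizing s s' f g with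
  | zero => exact Decays.mul hf hg
  | succ d ih =>
    refine ⟨hf.1.mul hg.1, ?_⟩
    have h₁ := ih hf.2 hg.lower.shift
    have h₂ := ih hf.lower hg.2
    rw [add_right_comm] at h₁
    rw [← add_assoc] at h₂
    refine (h₁.add h₂).congr (Eventually.of_forall fun k => ?_)
    simp only [Pi.add_apply, Pi.mul_apply, fwdDiff_one_apply]
    ring

/-- Induction through Δ(1/f) = -Δf / (f_k f_{k+1}). -/
theorem IsSymbol.inv {r d : ℕ} (hr : r ≠ 0) {f : ℕ → K → ℂ} (hf : IsSymbol r d 0 f) {δ : ℝ}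
    (hδ : 0 < δ) (h : ∀ᶠ k in atTop, ∀ x, δ ≤ ‖f k x‖) : IsSymbol r d 0 f⁻¹ := by
  induction d with
  | zero => exact Decays.inv hr hδ h
  | succ d ih =>
    refine ⟨Decays.inv hr hδ h, ?_⟩
    have hi := ih hf.lower
    refine ((hf.2.neg.mul hi).mul hi.shift).congr ?_
    filter_upwards [h, (tendsto_add_atTop_nat 1).eventually h] with k hk hk'
    ext x
    have h₁ : f k x ≠ 0 := norm_pos_iff.1 (hδ.trans_le (hk x))
    have h₂ : f (k + 1) x ≠ 0 := norm_pos_iff.1 (hδ.trans_le (hk' x))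
    simp only [Pi.mul_apply, Pi.neg_apply, Pi.inv_apply, Pi.sub_apply, fwdDiff_one_apply]
    field_simp
    ring

/-- Since Δf = Δ(f²) / (f_{k+1} + f_k), a square root inherits the regularity of its square as long
as consecutive values do not cancel. -/
theorem IsSymbol.of_sq {r d : ℕ} (hr : r ≠ 0) {f g : ℕ → K → ℂ} (hg : IsSymbol r d 0 g)
    (hf : Decays r 0 f) (hfg : ∀ᶠ k in atTop, f k ^ 2 = g k) {δ : ℝ} (hδ : 0 < δ)
    (h : ∀ᶠ k in atTop, ∀ x, δ ≤ ‖f (k + 1) x + f k x‖) : IsSymbol r d 0 f := by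
  induction d with
  | zero => exact hf
  | succ d ih =>
    refine ⟨hf, ?_⟩
    have hi := ih hg.lower
    refine (hg.2.mul ((hi.shift.add hi).inv hr hδ h)).congr ?_
    filter_upwards [h, hfg, (tendsto_add_atTop_nat 1).eventually hfg] with k hk h₁ h₂
    ext x
    have h₀ : f (k + 1) x + f k x ≠ 0 := norm_pos_iff.1 (hδ.trans_le (hk x))
    simp only [Pi.mul_apply, Pi.add_apply, Pi.inv_apply, Pi.sub_apply, fwdDiff_one_apply, ← h₁,
      ← h₂, Pi.pow_apply]
    field_simp
    ring

theorem IsSymbol.const_mul {r d s : ℕ} {f : ℕ → K → ℂ} (hf : IsSymbol r d s f) (c : ℂ) :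
    IsSymbol r d s (fun k x => c * f k x) := by
  have h {m : ℕ} {g : ℕ → K → ℂ} (hg : Decays r m g) : Decays r m (fun k x => c * g k x) :=
    hg.of_norm_le (c := ‖c‖) (Eventually.of_forall fun k x => by simp)
  induction d generalizing s f with
  | zero => exact h hf
  | succ d ih =>
    refine ⟨h hf.1, (ih hf.2).congr (Eventually.of_forall fun k => ?_)⟩
    ext x
    simp only [Pi.sub_apply, fwdDiff_one_apply]
    ring

theorem isSymbol_const {r : ℕ} (hr : r ≠ 0) (d : ℕ) (c : ℂ) :
    IsSymbol r d 0 (fun (_ : ℕ) (_ : K) => c) := by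
  have h₀ (d s : ℕ) : IsSymbol r d s (0 : ℕ → K → ℂ) := by
    induction d generalizing s with
    | zero => exact ⟨0, 0, le_rfl, fun _ => le_rfl, by simp [hr], by simp⟩
    | succ d ih =>
      refine ⟨⟨0, 0, le_rfl, fun _ => le_rfl, by simp [hr], by simp⟩,
        (ih (s + 1)).congr (Eventually.of_forall fun k => ?_)⟩
      simp [fwdDiff_one_apply]
  have hc : Decays r 0 (fun (_ : ℕ) (_ : K) => c) :=
    (decays_zero_iff hr).2 ⟨‖c‖, by simp⟩
  cases d with
  | zero => exact hc
  | succ d =>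
    refine ⟨hc, (h₀ d 1).congr (Eventually.of_forall fun k => ?_)⟩
    simp [fwdDiff_one_apply]

/-- A symbol in terms of its iterated differences. -/
theorem isSymbol_of_iterate {r d s : ℕ} {f : ℕ → K → ℂ}
    (h : ∀ j ≤ d, Decays r (s + j) ((fwdDiff 1)^[j] f)) : IsSymbol r d s f := by
  induction d generalizing s f with
  | zero => exact h 0 le_rfl
  | succ d ih =>
    refine ⟨h 0 (Nat.zero_le _), ih fun j hj => ?_⟩
    have := h (j + 1) (by omega)
    rwa [Function.iterate_succ_apply, show s + (j + 1) = s + 1 + j by ring] at this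

end Symbols

/-! ### Recurrences with a summable antilinear part. -/

section Recurrence

variable {K : Type*} [TopologicalSpace K] [CompactSpace K]

/-- A sequence whose relative increments are uniformly summable converges uniformly, and its limit
has no zeros if the sequence has none. -/
theorem exists_uniform_limit_of_relative_increments {ζ : ℕ → K → ℂ} {ε : ℕ → ℝ}
    (hζ : ∀ k, Continuous (ζ k)) (hε : ∀ k, 0 ≤ ε k) (hε' : Summable ε)
    (h : ∀ k x, ‖ζ (k + 1) x - ζ k x‖ ≤ ε k * ‖ζ k x‖) (h₀ : ∀ k x, ζ k x ≠ 0) :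
    ∃ ψ : K → ℂ, TendstoUniformly ζ ψ atTop ∧ Continuous ψ ∧ ∀ x, ψ x ≠ 0 := by
  have hsum (n : ℕ) : ∑ j ∈ Finset.range n, ε j ≤ ∑' j, ε j :=
    hε'.sum_le_tsum _ fun j _ => hε j
  -- Each step multiplies the norm by at most 1 + ε ≤ exp ε. The resulting bound makes the
  -- increments of ζ uniformly summable.
  have hbd (n : ℕ) (x : K) : ‖ζ n x‖ ≤ Real.exp (∑ j ∈ Finset.range n, ε j) * ‖ζ 0 x‖ := by
    induction n with
    | zero => simp
    | succ n ih =>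
      rw [Finset.sum_range_succ, Real.exp_add]
      calc ‖ζ (n + 1) x‖ ≤ ‖ζ (n + 1) x - ζ n x‖ + ‖ζ n x‖ := norm_le_norm_sub_add _ _
        _ ≤ (ε n + 1) * ‖ζ n x‖ := by linarith [h n x]
        _ ≤ Real.exp (ε n) * ‖ζ n x‖ := by gcongr; exact Real.add_one_le_exp _
        _ ≤ Real.exp (ε n) * (Real.exp (∑ j ∈ Finset.range n, ε j) * ‖ζ 0 x‖) := by gcongr
        _ = _ := by ring
  obtain ⟨M, hM⟩ := (isCompact_univ (X := K)).exists_bound_of_continuousOn (hζ 0).continuousOn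
  have hinc (n : ℕ) (x : K) :
      ‖ζ (n + 1) x - ζ n x‖ ≤ ε n * (Real.exp (∑' j, ε j) * M) := by
    refine (h n x).trans (mul_le_mul_of_nonneg_left ((hbd n x).trans ?_) (hε n))
    gcongr
    · exact hsum n
    · exact hM x trivial
  have hconv := tendstoUniformly_tsum_nat (hε'.mul_right (Real.exp (∑' j, ε j) * M)) hinc
  have htel (n : ℕ) (x : K) : ∑ j ∈ Finset.range n, (ζ (j + 1) x - ζ j x) = ζ n x - ζ 0 x :=
    Finset.sum_range_sub (fun j => ζ j x) n
  simp only [htel] at hconv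
  have hlim : TendstoUniformly ζ (fun x => ∑' n, (ζ (n + 1) x - ζ n x) + ζ 0 x) atTop := by
    rw [Metric.tendstoUniformly_iff] at hconv ⊢
    intro η hη
    filter_upwards [hconv η hη] with n hn x
    have := hn x
    rw [dist_eq_norm] at this ⊢
    convert this using 2
    ring
  refine ⟨_, hlim, hlim.continuous (Frequently.of_forall hζ), fun x => ?_⟩
  -- Once ε ≤ 1/2, one has 1 / (1 - ε) ≤ 1 + 2ε ≤ exp(2ε), so the norm loses only a bounded factor
  -- beyond `m` and the limit cannot vanish.
  obtain ⟨m, hm⟩ := eventually_atTop.1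
    (hε'.tendsto_atTop_zero.eventually_le_const (show (0 : ℝ) < 1 / 2 by norm_num))
  have hlow (n : ℕ) :
      ‖ζ m x‖ ≤ Real.exp (2 * ∑ j ∈ Finset.range n, ε (m + j)) * ‖ζ (m + n) x‖ := by
    induction n with
    | zero => simp
    | succ n ih =>
      refine ih.trans ?_
      rw [Finset.sum_range_succ, mul_add, Real.exp_add, mul_assoc, ← add_assoc]
      gcongr
      have h₁ := hm (m + n) (by omega)
      have h₂ : ‖ζ (m + n) x‖ ≤ ‖ζ (m + n + 1) x‖ + ε (m + n) * ‖ζ (m + n) x‖ := by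
        have := norm_le_norm_sub_add (ζ (m + n) x) (ζ (m + n + 1) x)
        rw [norm_sub_rev] at this
        linarith [h (m + n) x]
      have h₃ : ‖ζ (m + n) x‖ ≤ (2 * ε (m + n) + 1) * ‖ζ (m + n + 1) x‖ := by
        have h₄ := hε (m + n)
        have h₅ := norm_nonneg (ζ (m + n) x)
        have h₆ : ‖ζ (m + n) x‖ ≤ (2 * ε (m + n) + 1) * ((1 - ε (m + n)) * ‖ζ (m + n) x‖) := by
          nlinarith [mul_nonneg (mul_nonneg h₄ (show 0 ≤ 1 - 2 * ε (m + n) by linarith)) h₅]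
        refine h₆.trans ?_
        gcongr
        linarith
      refine h₃.trans ?_
      gcongr
      exact Real.add_one_le_exp _
  have hlow' (n : ℕ) : ‖ζ m x‖ ≤ Real.exp (2 * ∑' j, ε (m + j)) * ‖ζ (m + n) x‖ := by
    refine (hlow n).trans ?_
    gcongr
    refine Summable.sum_le_tsum _ (fun j _ => hε _) ?_
    simpa only [add_comm m] using (summable_nat_add_iff m).2 hε'
  have ht : Tendsto (fun n => ζ (m + n) x) atTop
      (𝓝 (∑' n, (ζ (n + 1) x - ζ n x) + ζ 0 x)) := by
    have := (tendsto_add_atTop_iff_nat m).2 (hlim.tendsto_at x)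
    simpa only [add_comm m] using this
  have := ge_of_tendsto' (ht.norm.const_mul _) hlow'
  intro h0
  rw [h0, norm_zero, mul_zero] at this
  exact h₀ m x (norm_le_zero_iff.1 this)

/-- The case of a summable antilinear part. -/
theorem exists_multipliers_of_summable {r : ℕ} {z α β : ℕ → K → ℂ}
    (hrec : ∀ᶠ k in atTop, ∀ x, z (k + 1) x = α k x * z k x + β k x * star (z k x))
    (hβ : Decays r r β) {δ : ℝ} (hδ : 0 < δ) (hαδ : ∀ᶠ k in atTop, ∀ x, δ ≤ ‖α k x‖)
    (hα : ∀ᶠ k in atTop, Continuous (α k)) (hz : ∀ᶠ k in atTop, Continuous (z k))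
    (hz₀ : ∀ᶠ k in atTop, ∀ x, z k x ≠ 0) :
    ∃ (k₀ : ℕ) (ψ : K → ℂ), 1 ≤ k₀ ∧ (∀ k ≥ k₀, Continuous (α k) ∧ ∀ x, δ ≤ ‖α k x‖) ∧
      TendstoUniformly (fun k x => z k x * ∏ j ∈ Finset.Ico k₀ k, (α j x)⁻¹) ψ atTop ∧
      Continuous ψ ∧ ∀ x, ψ x ≠ 0 := by
  obtain ⟨C, w, hC, hw, hw', hβ⟩ := hβ
  obtain ⟨k₀, hk⟩ := eventually_atTop.1
    ((((hrec.and hβ).and (hαδ.and hα)).and (hz.and hz₀)).and (eventually_ge_atTop 1))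
  have hk₀ : 1 ≤ k₀ := (hk k₀ le_rfl).2
  replace hk := fun k hk' => (hk k hk').1
  have hα₀ (k : ℕ) (hk' : k₀ ≤ k) (x : K) : α k x ≠ 0 :=
    norm_pos_iff.1 (hδ.trans_le ((hk k hk').1.2.1 x))
  obtain ⟨ψ, h₁, h₂, h₃⟩ := exists_uniform_limit_of_relative_increments
    (ζ := fun n x => z (n + k₀) x * ∏ j ∈ Finset.Ico k₀ (n + k₀), (α j x)⁻¹)
    (ε := fun n => C * w (n + k₀) ^ r / δ)
    (fun n => by
      refine ((hk (n + k₀) (by omega)).2.1).mul (continuous_finsetProd _ fun j hj => ?_)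
      have hj' := (Finset.mem_Ico.1 hj).1
      exact (hk j hj').1.2.2.inv₀ (hα₀ j hj'))
    (fun n => by have := hw (n + k₀); positivity)
    (((summable_nat_add_iff (f := fun k => w k ^ r) k₀).2 hw').mul_left C |>.div_const δ)
    (fun n x => by
      have hn : k₀ ≤ n + k₀ := by omega
      rw [show n + 1 + k₀ = n + k₀ + 1 by ring, Finset.prod_Ico_succ_top hn,
        (hk _ hn).1.1.1 x]
      have ha := hα₀ _ hn x
      -- The linear part cancels against the new factor of the product. What remains has relative
      -- size |β / α|, as conjugation preserves the modulus.
      have : (α (n + k₀) x * z (n + k₀) x + β (n + k₀) x * star (z (n + k₀) x)) *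
            ((∏ j ∈ Finset.Ico k₀ (n + k₀), (α j x)⁻¹) * (α (n + k₀) x)⁻¹) -
            z (n + k₀) x * ∏ j ∈ Finset.Ico k₀ (n + k₀), (α j x)⁻¹ =
          β (n + k₀) x * (α (n + k₀) x)⁻¹ *
            (star (z (n + k₀) x) * ∏ j ∈ Finset.Ico k₀ (n + k₀), (α j x)⁻¹) := by
        field_simp
        ring
      rw [this, norm_mul, norm_mul, norm_mul (star _), norm_star, ← norm_mul (z _ _), norm_inv,
        div_eq_mul_inv]
      have := hw (n + k₀)
      gcongr
      · exact (hk _ hn).1.1.2 x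
      · exact (hk _ hn).1.2.1 x)
    (fun n x => by
      refine mul_ne_zero ((hk (n + k₀) (by omega)).2.2 x) (Finset.prod_ne_zero_iff.2 fun j hj => ?_)
      exact inv_ne_zero (hα₀ j (Finset.mem_Ico.1 hj).1 x))
  refine ⟨k₀, ψ, hk₀, fun k hk' => ⟨(hk k hk').1.2.2, (hk k hk').1.2.1⟩, ?_, h₂, h₃⟩
  rw [Metric.tendstoUniformly_iff] at h₁ ⊢
  intro ε hε
  obtain ⟨n₀, hn₀⟩ := eventually_atTop.1 (h₁ ε hε)
  filter_upwards [eventually_ge_atTop (n₀ + k₀)] with k hk x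
  have := hn₀ (k - k₀) (by omega) x
  rwa [Nat.sub_add_cancel (by omega : k₀ ≤ k)] at this

end Recurrence

/-! ### Raising the order of the antilinear part by conjugation. -/

section Recurrence

variable {K : Type*}

theorem norm_sub_star (w : ℂ) : ‖w - star w‖ = 2 * |w.im| := by
  have : w - star w = (2 * w.im : ℝ) * Complex.I := by
    simpa using Complex.sub_conj w
  rw [this, norm_mul, Complex.norm_I, mul_one, Complex.norm_real, Real.norm_eq_abs, abs_mul]
  norm_num

theorem isSymbol_sub_star_inv {r d : ℕ} (hr : r ≠ 0) {α : ℕ → K → ℂ} (hα : IsSymbol r d 0 α)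
    {δ : ℝ} (hδ : 0 < δ) (him : ∀ᶠ k in atTop, ∀ x, δ ≤ |(α k x).im|) :
    IsSymbol r d 0 (α - star α)⁻¹ := by
  refine (hα.sub hα.conj).inv hr hδ ?_
  filter_upwards [him] with k hk x
  rw [Pi.sub_apply, Pi.star_apply, Pi.sub_apply, Pi.star_apply, norm_sub_star]
  linarith [hk x, abs_nonneg (α k x).im]

/-- The change of variable `y = z + c z̄` in the recurrence `z' = α z + β z̄`. -/
theorem conjugated_recurrence {α β c c' z z' : ℂ} (h : z' = α * z + β * star z)
    (hc : 1 - c * star c ≠ 0) :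
    z' + c' * star z' =
      (α + c' * star β - star c * (β + c' * star α)) * (1 - c * star c)⁻¹ * (z + c * star z) +
      (β + c' * star α - c * (α + c' * star β)) * (1 - c * star c)⁻¹ * star (z + c * star z) := by
  rw [h]
  simp only [star_add, star_mul', star_star]
  linear_combination (-(α + c' * star β) * z - (β + c' * star α) * star z) * mul_inv_cancel₀ hc

theorem norm_one_sub_mul_star {c : ℂ} (hc : ‖c‖ ≤ 1 / 2) : 1 / 2 ≤ ‖1 - c * star c‖ := by
  have h₁ : ‖c * star c‖ ≤ 1 / 2 * (1 / 2) := by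
    rw [norm_mul, norm_star]
    gcongr
  have h₂ := norm_sub_norm_le (1 : ℂ) (c * star c)
  rw [norm_one] at h₂
  linarith

theorem eventually_im_ge_of_tendstoUniformly {α α' : ℕ → K → ℂ}
    (h : TendstoUniformly (fun k x => α' k x - α k x) (fun _ => 0) atTop) {δ : ℝ} (hδ : 0 < δ)
    (him : ∀ᶠ k in atTop, ∀ x, δ ≤ |(α k x).im|) :
    ∀ᶠ k in atTop, ∀ x, δ / 2 ≤ |(α' k x).im| := by
  filter_upwards [him, Metric.tendstoUniformly_iff.1 h (δ / 2) (half_pos hδ)] with k hk hk' x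
  have h₁ := hk' x
  rw [dist_zero_left] at h₁
  have h₂ := (Complex.abs_im_le_norm _).trans h₁.le
  rw [Complex.sub_im] at h₂
  have h₃ := abs_sub_abs_le_abs_sub (α k x).im (α' k x).im
  rw [abs_sub_comm] at h₃
  linarith [hk x]

variable [TopologicalSpace K] [CompactSpace K]

/-- Solutions of `z_{k+1} = α_k z_k + β_k z̄_k` are asymptotic to a product of multipliers
close to `α_k`, provided that `β` is a symbol of positive order. -/
theorem exists_multipliers {r d s : ℕ} (hs : s ≠ 0) (hd : d + s = r) {z α β : ℕ → K → ℂ}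
    (hrec : ∀ᶠ k in atTop, ∀ x, z (k + 1) x = α k x * z k x + β k x * star (z k x))
    (hα : IsSymbol r d 0 α) (hβ : IsSymbol r d s β) {δ : ℝ} (hδ : 0 < δ)
    (him : ∀ᶠ k in atTop, ∀ x, δ ≤ |(α k x).im|)
    (hαc : ∀ᶠ k in atTop, Continuous (α k)) (hβc : ∀ᶠ k in atTop, Continuous (β k))
    (hzc : ∀ᶠ k in atTop, Continuous (z k)) (hz₀ : ∀ᶠ k in atTop, ∀ x, z k x ≠ 0) :
    ∃ (τ : ℕ → K → ℂ) (η : ℝ) (k₀ : ℕ) (ψ : K → ℂ), 0 < η ∧ 1 ≤ k₀ ∧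
      (∀ k ≥ k₀, Continuous (τ k) ∧ ∀ x, η ≤ ‖τ k x‖) ∧
      TendstoUniformly (fun k x => τ k x - α k x) (fun _ => 0) atTop ∧
      TendstoUniformly (fun k x => z k x * ∏ j ∈ Finset.Ico k₀ k, (τ j x)⁻¹) ψ atTop ∧
      Continuous ψ ∧ ∀ x, ψ x ≠ 0 := by
  induction d generalizing s z α β δ with
  | zero =>
    obtain rfl : s = r := by omega
    obtain ⟨k₀, ψ, hk₀, h₁, h₂⟩ := exists_multipliers_of_summable hrec hβ hδ
      (him.mono fun k hk x => (hk x).trans (Complex.abs_im_le_norm _)) hαc hzc hz₀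
    refine ⟨α, δ, k₀, ψ, hδ, hk₀, h₁, ?_, h₂⟩
    simp only [sub_self]
    exact Metric.tendstoUniformly_iff.2 fun ε hε => by simp [hε]
  | succ d ih =>
    have hr : r ≠ 0 := by omega
    -- This `c` solves c (α - conj α) = β, which kills the new antilinear coefficient up to Δc and
    -- terms of higher order.
    obtain ⟨c, hcdef⟩ : ∃ c : ℕ → K → ℂ, c = β * (α - star α)⁻¹ := ⟨_, rfl⟩
    have hc : IsSymbol r (d + 1) s c := by
      rw [hcdef]
      exact hβ.mul (isSymbol_sub_star_inv hr hα hδ him)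
    have hcs : ∀ᶠ k in atTop, ∀ x, ‖c k x‖ ≤ 1 / 2 :=
      hc.decays.eventually_le hs (by norm_num)
    obtain ⟨D, hDdef⟩ : ∃ D : ℕ → K → ℂ, D = fun k x => 1 - c k x * star (c k x) := ⟨_, rfl⟩
    have hD : ∀ᶠ k in atTop, ∀ x, 1 / 2 ≤ ‖D k x‖ := by
      filter_upwards [hcs] with k hk x
      rw [hDdef]
      exact norm_one_sub_mul_star (hk x)
    have hD₀ : ∀ᶠ k in atTop, ∀ x, D k x ≠ 0 := by
      filter_upwards [hD] with k hk x
      exact norm_pos_iff.1 (by linarith [hk x])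
    have hα₀ : ∀ᶠ k in atTop, ∀ x, α k x - star (α k x) ≠ 0 := by
      filter_upwards [him] with k hk x
      rw [← norm_pos_iff, norm_sub_star]
      linarith [hk x]
    have hDi : IsSymbol r (d + 1) 0 D⁻¹ := by
      refine IsSymbol.inv hr (δ := 1 / 2) ?_ (by norm_num) hD
      have := (isSymbol_const (K := K) hr (d + 1) 1).sub ((hc.mul hc.conj).mono (Nat.zero_le _))
      rw [hDdef]
      exact this
    obtain ⟨y, hy⟩ : ∃ y : ℕ → K → ℂ, y = fun k x => z k x + c k x * star (z k x) := ⟨_, rfl⟩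
    obtain ⟨α', hα'def⟩ : ∃ α' : ℕ → K → ℂ, α' = fun k x =>
      (α k x + c (k + 1) x * star (β k x) - star (c k x) *
        (β k x + c (k + 1) x * star (α k x))) * (D k x)⁻¹ := ⟨_, rfl⟩
    obtain ⟨β', hβ'def⟩ : ∃ β' : ℕ → K → ℂ, β' = fun k x =>
      (β k x + c (k + 1) x * star (α k x) - c k x *
        (α k x + c (k + 1) x * star (β k x))) * (D k x)⁻¹ := ⟨_, rfl⟩
    have hα' : IsSymbol r (d + 1) 0 α' := by
      rw [hα'def]
      exact ((hα.add ((hc.shift.mul hβ.conj).mono (Nat.zero_le _))).sub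
        ((hc.conj.mul (hβ.add (hc.shift.mul hα.conj))).mono (Nat.zero_le _))).mul hDi
    -- Substituting β = c (α - conj α) gives β' = (Δc · conj α - c_k c_{k+1} conj β) / D. The first
    -- term has order s + 1 at the price of one difference; the second has order 3s ≥ s + 1.
    have hβ' : IsSymbol r d (s + 1) β' := by
      have h₁ : IsSymbol r d (s + 1) (fwdDiff 1 c * star α) := hc.2.mul hα.conj.lower
      have h₂ : IsSymbol r d (s + 1) (c * (fun k => c (k + 1)) * star β) :=
        ((hc.lower.mul hc.lower.shift).mul hβ.conj.lower).mono (by omega)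
      refine ((h₁.sub h₂).mul hDi.lower).congr ?_
      filter_upwards [hα₀] with k hk
      ext x
      have h₀ := hk x
      have hce : c k x * (α k x - star (α k x)) = β k x := by
        rw [hcdef]
        simp only [Pi.mul_apply, Pi.sub_apply, Pi.inv_apply, Pi.star_apply]
        field_simp
      rw [hβ'def]
      simp only [Pi.mul_apply, Pi.sub_apply, Pi.inv_apply, Pi.star_apply, fwdDiff_one_apply]
      rw [← hce]
      ring
    -- Every term of α' - α contains a factor `c`, so the difference has order at least s ≥ 1.
    have hdiff : TendstoUniformly (fun k x => α' k x - α k x) (fun _ => 0) atTop := by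
      have h : IsSymbol r d s ((((fun k => c (k + 1)) * star β - star c * β -
          star c * ((fun k => c (k + 1)) * star α)) + α * c * star c) * D⁻¹) := by
        have h₁ := ((hc.shift.mul hβ.conj).mono (s' := s) (by omega)).sub
          ((hc.conj.mul hβ).mono (by omega))
        have h₂ := (hc.conj.mul (hc.shift.mul hα.conj)).mono (s' := s) (by omega)
        have h₃ := ((hα.mul hc).mul hc.conj).mono (s' := s) (by omega)
        exact (((h₁.sub h₂).add h₃).mul hDi).lower
      refine (h.congr ?_).decays.tendstoUniformly hs
      filter_upwards [hD₀] with k hk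
      ext x
      have h₀ := hk x
      have hDe : D k x = 1 - c k x * star (c k x) := by rw [hDdef]
      rw [hα'def]
      simp only [Pi.mul_apply, Pi.sub_apply, Pi.inv_apply, Pi.star_apply, Pi.add_apply]
      field_simp
      rw [hDe]
      ring
    have hcc : ∀ᶠ k in atTop, Continuous (c k) := by
      filter_upwards [hαc, hβc, hα₀] with k h₁ h₂ h₃
      rw [hcdef]
      exact h₂.mul ((h₁.sub h₁.star).inv₀ h₃)
    have hDc : ∀ᶠ k in atTop, Continuous fun x => (D k x)⁻¹ := by
      filter_upwards [hcc, hD₀] with k h₁ h₂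
      refine Continuous.inv₀ ?_ h₂
      rw [hDdef]
      exact continuous_const.sub (h₁.mul h₁.star)
    have hcc' := (tendsto_add_atTop_nat 1).eventually hcc
    obtain ⟨τ, η, k₀, ψ, hη, hk₀, h₁, h₂, h₃, h₄⟩ := ih (s := s + 1) (z := y) (α := α') (β := β')
      (Nat.succ_ne_zero s) (by omega)
      (by
        filter_upwards [hrec, hD₀] with k h₁ h₂ x
        rw [hy, hα'def, hβ'def]
        have h₃ := h₂ x
        rw [hDdef] at h₃ ⊢
        exact conjugated_recurrence (h₁ x) h₃)
      hα'.lower hβ' (half_pos hδ) (eventually_im_ge_of_tendstoUniformly hdiff hδ him)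
      (by
        filter_upwards [hαc, hβc, hcc, hcc', hDc] with k h₁ h₂ h₃ h₄ h₅
        rw [hα'def]
        fun_prop)
      (by
        filter_upwards [hαc, hβc, hcc, hcc', hDc] with k h₁ h₂ h₃ h₄ h₅
        rw [hβ'def]
        fun_prop)
      (by
        filter_upwards [hzc, hcc] with k h₁ h₂
        rw [hy]
        fun_prop)
      (by
        filter_upwards [hz₀, hcs] with k h₁ h₂ x h₀
        rw [hy] at h₀
        have h₃ : ‖z k x‖ = ‖c k x‖ * ‖z k x‖ := by
          simpa using congrArg norm (eq_neg_of_add_eq_zero_left h₀)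
        have h₄ := norm_pos_iff.2 (h₁ x)
        nlinarith [h₂ x])
    refine ⟨τ, η, k₀, ψ, hη, hk₀, h₁, ?_, ?_, h₄⟩
    · convert h₂.add hdiff using 1
      · ext k x
        simp
      · exact (add_zero (0 : K → ℂ)).symm
    -- Return from `y` to `z`: the normalised `y` is bounded by |M| + 1 and |z| ≤ 2|y|, so taking
    -- |c| ≤ ε / (4(|M| + 1)) moves it by at most ε / 2.
    · obtain ⟨M, hM⟩ := (isCompact_univ (X := K)).exists_bound_of_continuousOn h₄.1.continuousOn
      rw [Metric.tendstoUniformly_iff] at h₃ ⊢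
      intro ε hε
      have hM' : 0 < |M| + 1 := by positivity
      filter_upwards [h₃ (min 1 (ε / 2)) (by positivity), hcs,
        hc.decays.eventually_le hs (show 0 < ε / (4 * (|M| + 1)) by positivity)] with k h₅ h₆ h₇ x
      have h₅ := h₅ x
      set P := ∏ j ∈ Finset.Ico k₀ k, (τ j x)⁻¹
      have hyz : y k x = z k x + c k x * star (z k x) := by rw [hy]
      have hzy : ‖z k x‖ ≤ 2 * ‖y k x‖ := by
        have h₈ : ‖z k x‖ ≤ ‖y k x‖ + ‖c k x‖ * ‖z k x‖ := by
          have := norm_sub_le (y k x) (c k x * star (z k x))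
          rwa [hyz, add_sub_cancel_right, norm_mul, norm_star, ← hyz] at this
        nlinarith [h₆ x, norm_nonneg (z k x)]
      have hyP : ‖y k x * P‖ ≤ |M| + 1 := by
        have := norm_le_norm_add_norm_sub' (y k x * P) (ψ x)
        rw [dist_comm, dist_eq_norm] at h₅
        linarith [hM x trivial, le_abs_self M, h₅.le.trans (min_le_left _ _)]
      have hdist : ‖y k x * P - z k x * P‖ ≤ ε / 2 := by
        rw [← sub_mul, hyz, add_sub_cancel_left, norm_mul, norm_mul, norm_star]
        calc ‖c k x‖ * ‖z k x‖ * ‖P‖ ≤ ε / (4 * (|M| + 1)) * (2 * ‖y k x‖) * ‖P‖ := by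
              gcongr
              exact h₇ x
          _ = ε / (4 * (|M| + 1)) * 2 * ‖y k x * P‖ := by rw [norm_mul]; ring
          _ ≤ ε / (4 * (|M| + 1)) * 2 * (|M| + 1) := by gcongr
          _ = ε / 2 := by field_simp; norm_num
      calc dist (ψ x) (z k x * P) ≤ dist (ψ x) (y k x * P) + dist (y k x * P) (z k x * P) :=
            dist_triangle _ _ _
        _ < ε / 2 + ε / 2 := by
            refine add_lt_add_of_lt_of_le (h₅.trans_le (min_le_right _ _)) ?_
            rwa [dist_eq_norm]
        _ = ε := add_halves ε

end Recurrence

/-! ### Pointwise limits that are automatically uniform, and limits from squares. -/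

section Polynomials

theorem exists_polynomial_transferProd (a b : ℕ → ℝ) (N n : ℕ) (p q : Fin 2) :
    ∃ P : Polynomial ℝ, P.natDegree ≤ N ∧ ∀ x, transferProd a b N n x p q = P.eval x := by
  induction N generalizing p with
  | zero =>
    exact ⟨Polynomial.C ((1 : Matrix (Fin 2) (Fin 2) ℝ) p q), by simp, by simp [transferProd]⟩
  | succ N ih =>
    obtain ⟨P, hP, hP'⟩ := ih 0
    obtain ⟨Q, hQ, hQ'⟩ := ih 1
    fin_cases p
    · refine ⟨Q, hQ.trans (Nat.le_succ N), fun x => ?_⟩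
      simp [transferProd, transfer, Matrix.mul_apply, Fin.sum_univ_two, hQ']
    · refine ⟨Polynomial.C (-(a (n + N - 1) / a (n + N))) * P +
        (Polynomial.C (a (n + N))⁻¹ * (Polynomial.X - Polynomial.C (b (n + N)))) * Q, ?_,
          fun x => ?_⟩
      · refine (Polynomial.natDegree_add_le _ _).trans (max_le ?_ ?_)
        · exact (Polynomial.natDegree_C_mul_le _ _).trans (by omega)
        · refine Polynomial.natDegree_mul_le.trans ?_
          rw [add_comm N]
          refine add_le_add ((Polynomial.natDegree_C_mul_le _ _).trans ?_) hQ
          exact (Polynomial.natDegree_X_sub_C _).le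
      · simp [transferProd, transfer, Matrix.mul_apply, Fin.sum_univ_two, hQ', hP']
        exact Or.inl (by ring)

/-- Polynomials of bounded degree which converge pointwise on a compact set converge uniformly. -/
theorem exists_uniform_limit_of_polynomials {K : Set ℝ} [CompactSpace K] {F : ℕ → K → ℝ} (m : ℕ)
    (hF : ∀ k, ∃ P : Polynomial ℝ, P.natDegree ≤ m ∧ ∀ x : K, F k x = P.eval (x : ℝ))
    (h : ∀ x, ∃ l, Tendsto (fun k => F k x) atTop (𝓝 l)) :
    ∃ f : K → ℝ, Continuous f ∧ TendstoUniformly F f atTop := by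
  -- Working with functions on K instead of coefficients keeps evaluation injective even when K is
  -- finite.
  let V : Submodule ℝ C(K, ℝ) :=
    (Polynomial.degreeLE ℝ m).map (Polynomial.toContinuousMapOnAlgHom K).toLinearMap
  have : FiniteDimensional ℝ (Polynomial.degreeLE ℝ (m : WithBot ℕ)) := by
    rw [← Polynomial.degreeLT_succ_eq_degreeLE]
    exact (Polynomial.degreeLTEquiv ℝ (m + 1)).symm.finiteDimensional
  have : FiniteDimensional ℝ V := inferInstance
  let E : V →ₗ[ℝ] (K → ℝ) := (ContinuousMap.coeFnLinearMap ℝ).comp V.subtype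
  have hE : LinearMap.ker E = ⊥ := by
    refine LinearMap.ker_eq_bot.2 fun f g hfg => Subtype.ext (DFunLike.coe_injective hfg)
  -- An injective linear map out of a finite-dimensional space is a closed embedding, so on `V` the
  -- topologies of pointwise and of uniform convergence agree, and the pointwise limit stays in `V`.
  have hemb := LinearMap.isClosedEmbedding_of_injective hE
  choose P hP hP' using hF
  let G : ℕ → V := fun k => ⟨Polynomial.toContinuousMapOnAlgHom K (P k),
    Submodule.mem_map_of_mem (Polynomial.mem_degreeLE.2
      (Polynomial.natDegree_le_iff_degree_le.1 (hP k)))⟩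
  have hG (k : ℕ) : E (G k) = F k := by
    ext x
    rw [hP' k x]
    rfl
  choose l hl using h
  have ht : Tendsto (fun k => E (G k)) atTop (𝓝 l) := by
    simp only [hG]
    exact tendsto_pi_nhds.2 hl
  obtain ⟨g, hg⟩ : l ∈ Set.range E :=
    hemb.isClosed_range.mem_of_tendsto ht (Eventually.of_forall fun k => ⟨_, rfl⟩)
  rw [← hg] at ht
  have ht' : Tendsto (fun k => (G k : C(K, ℝ))) atTop (𝓝 (g : C(K, ℝ))) :=
    (continuous_subtype_val.tendsto g).comp (hemb.isInducing.tendsto_nhds_iff.2 ht)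
  refine ⟨(g : C(K, ℝ)), (g : C(K, ℝ)).continuous, ?_⟩
  have hu := ContinuousMap.tendsto_iff_tendstoUniformly.1 ht'
  convert hu using 1
  ext k x
  rw [← hG k]
  rfl

/-- The absolute values converge to √g. If √g > 0, a late change of sign would need a jump larger
than √g, which vanishing increments exclude. -/
theorem exists_tendsto_of_sq {u : ℕ → ℝ} {g : ℝ}
    (hu : Tendsto (fun k => u k ^ 2) atTop (𝓝 g))
    (hd : Tendsto (fun k => u (k + 1) - u k) atTop (𝓝 0)) : ∃ l, Tendsto u atTop (𝓝 l) := by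
  have habs : Tendsto (fun k => |u k|) atTop (𝓝 (√g)) := by
    simpa only [Real.sqrt_sq_eq_abs] using hu.sqrt
  rcases (Real.sqrt_nonneg g).eq_or_lt with h | h
  · rw [← h] at habs
    exact ⟨0, tendsto_zero_iff_abs_tendsto_zero _ |>.2 habs⟩
  · have h₁ := habs.eventually_const_lt (half_lt_self h)
    have h₂ := hd.abs.eventually_lt_const (u := √g) (by rwa [abs_zero])
    obtain ⟨m, hm⟩ := eventually_atTop.1 (h₁.and h₂)
    rcases le_total 0 (u m) with hs | hs
    · have hpos (k : ℕ) (hk : m ≤ k) : 0 ≤ u k := by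
        induction k, hk using Nat.le_induction with
        | base => exact hs
        | succ k hk ih =>
          by_contra! hneg
          have h₃ := (hm (k + 1) (by omega)).1
          have h₄ := (hm k hk).1
          have h₅ := (hm k hk).2
          rw [abs_of_neg hneg] at h₃
          rw [abs_of_nonneg ih] at h₄
          have := neg_abs_le (u (k + 1) - u k)
          linarith
      refine ⟨√g, habs.congr' ?_⟩
      filter_upwards [eventually_ge_atTop m] with k hk
      exact abs_of_nonneg (hpos k hk)
    · have hneg (k : ℕ) (hk : m ≤ k) : u k ≤ 0 := by
        induction k, hk using Nat.le_induction with
        | base => exact hs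
        | succ k hk ih =>
          by_contra! hpos
          have h₃ := (hm (k + 1) (by omega)).1
          have h₄ := (hm k hk).1
          have h₅ := (hm k hk).2
          rw [abs_of_pos hpos] at h₃
          rw [abs_of_nonpos ih] at h₄
          have := le_abs_self (u (k + 1) - u k)
          linarith
      refine ⟨-√g, habs.neg.congr' ?_⟩
      filter_upwards [eventually_ge_atTop m] with k hk
      rw [abs_of_nonpos (hneg k hk), neg_neg]

end Polynomials

/-! ### Transfer matrices acting on consecutive polynomials. -/

section Transfer

variable {a b : ℕ → ℝ}

theorem det_transferProd (ha : ∀ n, 0 < a n) (N : ℕ) {n : ℕ} (hn : 1 ≤ n) (x : ℝ) :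
    (transferProd a b N n x).det = a (n - 1) / a (n + N - 1) := by
  induction N with
  | zero => simp [transferProd, (ha _).ne']
  | succ N ih =>
    rw [transferProd, Matrix.det_mul, ih, transfer, Matrix.det_fin_two_of]
    have h₁ := (ha (n + N - 1)).ne'
    have h₂ := (ha (n + N)).ne'
    rw [show n + (N + 1) - 1 = n + N by omega]
    field_simp
    ring

theorem transferProd_mulVec (ha : ∀ n, 0 < a n) (N : ℕ) {n : ℕ} (hn : 1 ≤ n) (x : ℝ) :
    (transferProd a b N n x).mulVec ![orthoPoly a b (n - 1) x, orthoPoly a b n x] =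
      ![orthoPoly a b (n + N - 1) x, orthoPoly a b (n + N) x] := by
  induction N with
  | zero => simp [transferProd]
  | succ N ih =>
    rw [transferProd, ← Matrix.mulVec_mulVec, ih]
    obtain ⟨m, hm⟩ : ∃ m, n + N = m + 1 := ⟨n + N - 1, by omega⟩
    rw [show n + (N + 1) - 1 = n + N by omega, show n + (N + 1) = n + N + 1 by omega, hm]
    have h := (ha (m + 1)).ne'
    ext j
    fin_cases j
    · simp [transfer, Matrix.mulVec, dotProduct, Fin.sum_univ_two]
    · simp [transfer, Matrix.mulVec, dotProduct, Fin.sum_univ_two, orthoPoly]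
      field_simp
      ring

theorem continuous_orthoPoly (n : ℕ) : Continuous (orthoPoly a b n) := by
  induction n using Nat.twoStepInduction with
  | zero => exact continuous_const
  | one =>
    change Continuous fun x => (x - b 0) / a 0
    fun_prop
  | more n ih₁ ih₂ =>
    change Continuous fun x => ((x - b (n + 1)) * orthoPoly a b (n + 1) x -
      a n * orthoPoly a b n x) / a (n + 1)
    fun_prop

/-- Two consecutive zeros would propagate down the recurrence to p_0 = 1. -/
theorem orthoPoly_ne_zero_or (ha : ∀ n, 0 < a n) (n : ℕ) (x : ℝ) :
    orthoPoly a b n x ≠ 0 ∨ orthoPoly a b (n + 1) x ≠ 0 := by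
  induction n with
  | zero => exact Or.inl one_ne_zero
  | succ n ih =>
    by_contra! h
    obtain ⟨h₁, h₂⟩ := h
    have h₃ : ((x - b (n + 1)) * orthoPoly a b (n + 1) x - a n * orthoPoly a b n x) / a (n + 1)
      = 0 := h₂
    rw [h₁, mul_zero, zero_sub, div_eq_zero_iff, neg_eq_zero, mul_eq_zero] at h₃
    rcases ih with h | h
    · rcases h₃ with (h₃ | h₃) | h₃
      · exact (ha n).ne' h₃
      · exact h h₃
      · exact (ha _).ne' h₃
    · exact h h₁

end Transfer

/-! ### Complex coordinate of a real vector in a conjugate eigenbasis. -/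

section EigenCoordinate

/-- The eigenvalue of a real `2 × 2` matrix of negative discriminant in the upper half-plane. -/
noncomputable def upperEigenvalue (M : Matrix (Fin 2) (Fin 2) ℝ) : ℂ :=
  (M.trace : ℂ) / 2 + Complex.I / 2 * (Real.sqrt |discr M| : ℂ)

theorem upperEigenvalue_re (M : Matrix (Fin 2) (Fin 2) ℝ) :
    (upperEigenvalue M).re = M.trace / 2 := by
  simp [upperEigenvalue]

theorem upperEigenvalue_im (M : Matrix (Fin 2) (Fin 2) ℝ) :
    (upperEigenvalue M).im = √|discr M| / 2 := by
  simp [upperEigenvalue]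
  ring

theorem upperEigenvalue_char {M : Matrix (Fin 2) (Fin 2) ℝ} (h : discr M < 0) :
    (upperEigenvalue M - M 0 0) * (upperEigenvalue M - M 1 1) = M 0 1 * M 1 0 := by
  have h₁ : ((√|discr M| : ℝ) : ℂ) ^ 2 = -(discr M : ℂ) := by
    rw [← Complex.ofReal_pow, Real.sq_sqrt (abs_nonneg _), abs_of_neg h, Complex.ofReal_neg]
  have h₂ : (discr M : ℂ) = (M 0 0 - M 1 1) ^ 2 + 4 * (M 0 1 * M 1 0) := by
    rw [discr, Matrix.trace_fin_two, Matrix.det_fin_two]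
    push_cast
    ring
  rw [h₂] at h₁
  rw [upperEigenvalue, Matrix.trace_fin_two]
  push_cast
  linear_combination (-1 / 4 : ℂ) * h₁ + (((√|discr M| : ℝ) : ℂ) ^ 2 / 4) * Complex.I_sq

theorem norm_upperEigenvalue_sq {M : Matrix (Fin 2) (Fin 2) ℝ} (h : discr M < 0) :
    ‖upperEigenvalue M‖ ^ 2 = M.det := by
  rw [← Complex.normSq_eq_norm_sq, Complex.normSq_apply, upperEigenvalue_re, upperEigenvalue_im]
  have h₁ := Real.sq_sqrt (abs_nonneg (discr M))
  rw [abs_of_neg h, discr] at h₁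
  rw [abs_of_neg h, discr]
  linarith

/-- The coordinate of the real vector `(v, w)` along `(e, 1)` in the basis `(e, 1), (ē, 1)`. -/
noncomputable def eigenCoord (e : ℂ) (v w : ℝ) : ℂ := (v - star e * w) * (e - star e)⁻¹

theorem eigenCoord_add_star {e : ℂ} (he : e - star e ≠ 0) (v w : ℝ) :
    eigenCoord e v w + star (eigenCoord e v w) = w := by
  simp only [eigenCoord, star_mul', star_sub, star_inv₀, Complex.star_def,
    Complex.conj_ofReal, Complex.conj_conj] at he ⊢
  rw [show (starRingEnd ℂ) e - e = -(e - (starRingEnd ℂ) e) by ring, inv_neg]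
  field_simp
  ring

theorem mul_eigenCoord_add_star {e : ℂ} (he : e - star e ≠ 0) (v w : ℝ) :
    e * eigenCoord e v w + star e * star (eigenCoord e v w) = v := by
  simp only [eigenCoord, star_mul', star_sub, star_inv₀, Complex.star_def,
    Complex.conj_ofReal, Complex.conj_conj] at he ⊢
  rw [show (starRingEnd ℂ) e - e = -(e - (starRingEnd ℂ) e) by ring, inv_neg]
  field_simp
  ring

theorem eigenCoord_ne_zero {e : ℂ} (he : e - star e ≠ 0) {v w : ℝ} (h : v ≠ 0 ∨ w ≠ 0) :
    eigenCoord e v w ≠ 0 := by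
  intro h₀
  have h₁ := eigenCoord_add_star he v w
  have h₂ := mul_eigenCoord_add_star he v w
  simp only [h₀, star_zero, mul_zero, add_zero] at h₁ h₂
  rcases h with h | h
  · exact h (by exact_mod_cast h₂.symm)
  · exact h (by exact_mod_cast h₁.symm)

/-- The matrix sends z (e, 1) + conj to l z (e, 1) + conj; re-expanding this in the basis of e'
gives corrections proportional to e' - e and its conjugate. -/
theorem eigenCoord_step {p q s u v w : ℝ} {l e e' : ℂ} (h₁ : s * e + u = l)
    (h₂ : p * e + q = l * e) (he : e - star e ≠ 0) (he' : e' - star e' ≠ 0) :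
    eigenCoord e' (p * v + q * w) (s * v + u * w) =
      (l - (e' - e) * l * (e' - star e')⁻¹) * eigenCoord e v w +
        -(star ((e' - e) * l) * (e' - star e')⁻¹) * star (eigenCoord e v w) := by
  have hv := mul_eigenCoord_add_star he v w
  have hw := eigenCoord_add_star he v w
  have h₁' : s * star e + u = star l := by simpa using congrArg star h₁
  have h₂' : p * star e + q = star l * star e := by simpa [mul_comm] using congrArg star h₂
  generalize eigenCoord e v w = z at hv hw ⊢
  have hs : star ((e' - e) * l) = (star e' - star e) * star l := by simp
  rw [eigenCoord, hs]
  push_cast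
  rw [← hv, ← hw]
  have hi := mul_inv_cancel₀ he'
  generalize (e' - star e')⁻¹ = j at hi ⊢
  linear_combination (z * j) * h₂ + (star z * j) * h₂' - (star e' * z * j) * h₁ -
    (star e' * star z * j) * h₁' + l * z * hi

/-- The second coordinate of the image is l z + conj(l z), and subtracting conj(l) (z + conj z)
removes the conjugate part. -/
theorem sub_star_mul_eigenCoord {s u v w : ℝ} {l e : ℂ} (h₁ : s * e + u = l)
    (he : e - star e ≠ 0) :
    ((s * v + u * w : ℝ) : ℂ) - star l * w = (l - star l) * eigenCoord e v w := by
  have hv := mul_eigenCoord_add_star he v w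
  have hw := eigenCoord_add_star he v w
  have h₁' : s * star e + u = star l := by simpa using congrArg star h₁
  generalize eigenCoord e v w = z at hv hw ⊢
  push_cast
  rw [← hv, ← hw]
  linear_combination z * h₁ + star z * h₁'

end EigenCoordinate

/-! ### Slowly varying elliptic systems. -/

section Elliptic

variable {K : Type*}

theorem isSymbol_upperEigenvalue {r d : ℕ} (hr : r ≠ 0)
    {X : ℕ → K → Matrix (Fin 2) (Fin 2) ℝ}
    (hX : ∀ p q, IsSymbol r d 0 (fun k x => (X k x p q : ℂ))) {δ : ℝ} (hδ : 0 < δ)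
    (hdisc : ∀ᶠ k in atTop, ∀ x, discr (X k x) ≤ -δ) :
    IsSymbol r d 0 (fun k x => upperEigenvalue (X k x)) := by
  have htr : IsSymbol r d 0 (fun k x => ((X k x).trace : ℂ)) :=
    ((hX 0 0).add (hX 1 1)).congr (Eventually.of_forall fun k => by
      ext x
      simp [Matrix.trace_fin_two])
  have hdet : IsSymbol r d 0 (fun k x => ((X k x).det : ℂ)) :=
    (((hX 0 0).mul (hX 1 1)).sub ((hX 0 1).mul (hX 1 0))).congr (Eventually.of_forall fun k => by
      ext x
      simp [Matrix.det_fin_two])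
  have hdis : IsSymbol r d 0 (fun k x => -(discr (X k x) : ℂ)) :=
    ((hdet.const_mul 4).sub (htr.mul htr)).congr (Eventually.of_forall fun k => by
      ext x
      simp [discr]
      ring)
  have hroot : IsSymbol r d 0 (fun k x => (√|discr (X k x)| : ℂ)) := by
    refine hdis.of_sq hr ?_ ?_ (Real.sqrt_pos.2 hδ) ?_
    · obtain ⟨C, hC⟩ := (decays_zero_iff hr).1 hdis.decays
      refine (decays_zero_iff hr).2 ⟨√C, ?_⟩
      filter_upwards [hC] with k hk x
      rw [Complex.norm_real, Real.norm_of_nonneg (Real.sqrt_nonneg _)]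
      refine Real.sqrt_le_sqrt ?_
      simpa using hk x
    · filter_upwards [hdisc] with k hk
      ext x
      rw [Pi.pow_apply, ← Complex.ofReal_pow, Real.sq_sqrt (abs_nonneg _),
        abs_of_neg (by linarith [hk x]), Complex.ofReal_neg]
    · filter_upwards [hdisc] with k hk x
      rw [← Complex.ofReal_add, Complex.norm_real, Real.norm_of_nonneg (by positivity)]
      refine (Real.sqrt_le_sqrt ?_).trans (le_add_of_nonneg_left (Real.sqrt_nonneg _))
      rw [abs_of_neg (by linarith [hk x])]
      linarith [hk x]
  refine ((htr.const_mul (1 / 2)).add (hroot.const_mul (Complex.I / 2))).congr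
    (Eventually.of_forall fun k => ?_)
  ext x
  simp only [Pi.add_apply, upperEigenvalue]
  ring

theorem continuous_upperEigenvalue : Continuous upperEigenvalue := by
  have : Continuous discr := by
    have h : discr = fun M => M.trace ^ 2 - 4 * M.det := rfl
    rw [h]
    fun_prop
  have h : upperEigenvalue = fun M => (M.trace : ℂ) / 2 +
    Complex.I / 2 * (Real.sqrt |discr M| : ℂ) := rfl
  rw [h]
  fun_prop

variable [TopologicalSpace K] [CompactSpace K]

/-- Asymptotics of the solutions of `v_{k+1} = X_k v_k` for slowly varying elliptic `X_k`. -/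
theorem exists_multipliers_of_elliptic {r : ℕ} (hr : r ≠ 0)
    {X : ℕ → K → Matrix (Fin 2) (Fin 2) ℝ} {v w : ℕ → K → ℝ}
    (hX : ∀ p q, IsSymbol r r 0 (fun k x => (X k x p q : ℂ))) (hXc : ∀ k, Continuous (X k))
    (hv : ∀ k, Continuous (v k)) (hw : ∀ k, Continuous (w k))
    (hvrec : ∀ᶠ k in atTop, ∀ x, v (k + 1) x = X k x 0 0 * v k x + X k x 0 1 * w k x)
    (hwrec : ∀ᶠ k in atTop, ∀ x, w (k + 1) x = X k x 1 0 * v k x + X k x 1 1 * w k x)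
    (hvw : ∀ᶠ k in atTop, ∀ x, v k x ≠ 0 ∨ w k x ≠ 0) {δ : ℝ} (hδ : 0 < δ)
    (hdisc : ∀ᶠ k in atTop, ∀ x, discr (X k x) ≤ -δ) :
    ∃ (τ z : ℕ → K → ℂ) (η : ℝ) (k₀ : ℕ) (ψ : K → ℂ), 0 < η ∧ 1 ≤ k₀ ∧
      (∀ k ≥ k₀, Continuous (τ k) ∧ ∀ x, η ≤ ‖τ k x‖) ∧
      TendstoUniformly (fun k x => τ k x - upperEigenvalue (X k x)) (fun _ => 0) atTop ∧
      (∀ᶠ k in atTop, ∀ x, (w (k + 1) x : ℂ) - star (upperEigenvalue (X k x)) * w k x =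
        (upperEigenvalue (X k x) - star (upperEigenvalue (X k x))) * z k x) ∧
      TendstoUniformly (fun k x => z k x * ∏ j ∈ Finset.Ico k₀ k, (τ j x)⁻¹) ψ atTop ∧
      Continuous ψ ∧ ∀ x, ψ x ≠ 0 := by
  obtain ⟨d, rfl⟩ : ∃ d, r = d + 1 := ⟨r - 1, by omega⟩
  obtain ⟨l, hl⟩ : ∃ l : ℕ → K → ℂ, l = fun k x => upperEigenvalue (X k x) := ⟨_, rfl⟩
  have hls : IsSymbol (d + 1) (d + 1) 0 l := by
    rw [hl]
    exact isSymbol_upperEigenvalue hr hX hδ hdisc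
  have hlc (k : ℕ) : Continuous (l k) := by
    rw [hl]
    exact continuous_upperEigenvalue.comp (hXc k)
  have hlim : ∀ᶠ k in atTop, ∀ x, √δ / 2 ≤ (l k x).im := by
    filter_upwards [hdisc] with k hk x
    rw [hl, upperEigenvalue_im]
    gcongr
    rw [abs_of_neg (by linarith [hk x])]
    linarith [hk x]
  have hδ' : 0 < √δ := Real.sqrt_pos.2 hδ
  obtain ⟨B, hB, hBX⟩ : ∃ B : ℝ, 0 < B ∧ ∀ᶠ k in atTop, ∀ x, |X k x 0 1| ≤ B ∧ |X k x 1 0| ≤ B := by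
    obtain ⟨C, hC⟩ := (decays_zero_iff hr).1 (hX 0 1).decays
    obtain ⟨D, hD⟩ := (decays_zero_iff hr).1 (hX 1 0).decays
    refine ⟨|C| + |D| + 1, by positivity, ?_⟩
    filter_upwards [hC, hD] with k h₁ h₂ x
    have h₁ := h₁ x
    have h₂ := h₂ x
    rw [Complex.norm_real, Real.norm_eq_abs] at h₁ h₂
    constructor <;> linarith [le_abs_self C, le_abs_self D, abs_nonneg C, abs_nonneg D]
  -- As discr X = (X₀₀ - X₁₁)² + 4 X₀₁ X₁₀, the bound discr X ≤ -δ forces |X₀₁ X₁₀| ≥ δ / 4.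
  have hs : ∀ᶠ k in atTop, ∀ x, δ / (4 * B) ≤ ‖(X k x 1 0 : ℂ)‖ := by
    filter_upwards [hdisc, hBX] with k h₁ h₂ x
    rw [Complex.norm_real, Real.norm_eq_abs, div_le_iff₀ (by positivity)]
    have h₃ := h₁ x
    rw [discr, Matrix.trace_fin_two, Matrix.det_fin_two] at h₃
    have h₄ : δ ≤ 4 * |X k x 0 1 * X k x 1 0| := by
      linarith [neg_abs_le (X k x 0 1 * X k x 1 0), sq_nonneg (X k x 0 0 - X k x 1 1)]
    rw [abs_mul] at h₄
    linarith [mul_le_mul_of_nonneg_right (h₂ x).1 (abs_nonneg (X k x 1 0))]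
  have hs₀ : ∀ᶠ k in atTop, ∀ x, (X k x 1 0 : ℂ) ≠ 0 := by
    filter_upwards [hs] with k hk x
    exact norm_pos_iff.1 (lt_of_lt_of_le (by positivity) (hk x))
  -- `e` solves the second row of the eigenvector equation for (e, 1); the first row then follows
  -- from the characteristic equation.
  obtain ⟨e, he⟩ : ∃ e : ℕ → K → ℂ, e = fun k x => (l k x - X k x 1 1) * (X k x 1 0 : ℂ)⁻¹ :=
    ⟨_, rfl⟩
  have hes : IsSymbol (d + 1) (d + 1) 0 e := by
    rw [he]
    exact (hls.sub (hX 1 1)).mul ((hX 1 0).inv hr (by positivity : 0 < δ / (4 * B)) hs)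
  have hec : ∀ᶠ k in atTop, Continuous (e k) := by
    filter_upwards [hs₀] with k hk
    rw [he]
    have h₁ (p q : Fin 2) : Continuous fun x => (X k x p q : ℂ) :=
      Complex.continuous_ofReal.comp ((hXc k).matrix_elem p q)
    exact ((hlc k).sub (h₁ 1 1)).mul ((h₁ 1 0).inv₀ hk)
  have he₁ : ∀ᶠ k in atTop, ∀ x, X k x 1 0 * e k x + X k x 1 1 = l k x := by
    filter_upwards [hs₀] with k hk x
    rw [he]
    have := hk x
    field_simp
    ring
  have he₂ : ∀ᶠ k in atTop, ∀ x, X k x 0 0 * e k x + X k x 0 1 = l k x * e k x := by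
    filter_upwards [hs₀, hdisc] with k hk hk' x
    have h₁ := upperEigenvalue_char (M := X k x) (by linarith [hk' x])
    rw [he, hl]
    have := hk x
    field_simp
    linear_combination -h₁
  have heim : ∀ᶠ k in atTop, ∀ x, √δ / (2 * B) ≤ |(e k x).im| := by
    filter_upwards [he₁, hlim, hBX] with k h₁ h₂ h₃ x
    have h₄ := congrArg Complex.im (h₁ x)
    rw [Complex.add_im, Complex.im_ofReal_mul, Complex.ofReal_im, add_zero] at h₄
    have h₅ := (h₂ x).trans (le_abs_self _)
    rw [← h₄, abs_mul] at h₅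
    rw [div_le_iff₀ (by positivity)]
    linarith [mul_le_mul_of_nonneg_right (h₃ x).2 (abs_nonneg (e k x).im)]
  have he₀ : ∀ᶠ k in atTop, ∀ x, e k x - star (e k x) ≠ 0 := by
    filter_upwards [heim] with k hk x
    rw [← norm_pos_iff, norm_sub_star]
    exact mul_pos two_pos (lt_of_lt_of_le (by positivity) (hk x))
  have he₀' := (tendsto_add_atTop_nat 1).eventually he₀
  have hec' := (tendsto_add_atTop_nat 1).eventually hec
  have hinv : IsSymbol (d + 1) (d + 1) 0 (e - star e)⁻¹ :=
    isSymbol_sub_star_inv hr hes (by positivity) heim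
  -- Passing to Δe spends one of the r = d + 1 differences and gains order 1, exactly the balance `d
  -- + s = r` at which the conjugation argument starts.
  have hdec : IsSymbol (d + 1) d 1
      (fwdDiff 1 e * l * (fun k => (e - star e)⁻¹ (k + 1))) :=
    (hes.2.mul hls.lower).mul hinv.lower.shift
  have hinvc : ∀ᶠ k in atTop, Continuous fun x => (e (k + 1) x - star (e (k + 1) x))⁻¹ := by
    filter_upwards [hec', he₀'] with k h₁ h₂
    exact (h₁.sub h₁.star).inv₀ h₂
  have hdiff : TendstoUniformly (fun k x => (l - fwdDiff 1 e * l *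
      (fun k => (e - star e)⁻¹ (k + 1))) k x - l k x) (fun _ => 0) atTop := by
    convert (hdec.neg.decays.tendstoUniformly one_ne_zero) using 3
    simp
  obtain ⟨τ, η, k₀, ψ, hη, hk₀, h₁, h₂, h₃⟩ := exists_multipliers (s := 1) (d := d)
    (z := fun k x => eigenCoord (e k x) (v k x) (w k x))
    (α := l - fwdDiff 1 e * l * (fun k => (e - star e)⁻¹ (k + 1)))
    (β := -(star (fwdDiff 1 e * l) * (fun k => (e - star e)⁻¹ (k + 1)))) one_ne_zero rfl
    (by
      filter_upwards [hvrec, hwrec, he₁, he₂, he₀, he₀'] with k g₁ g₂ g₃ g₄ g₅ g₆ x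
      rw [g₁ x, g₂ x]
      exact eigenCoord_step (g₃ x) (g₄ x) (g₅ x) (g₆ x))
    (hls.lower.sub (hdec.mono (Nat.zero_le _)))
    ((hes.2.mul hls.lower).conj.mul hinv.lower.shift).neg
    (half_pos (half_pos hδ'))
    (eventually_im_ge_of_tendstoUniformly hdiff (half_pos hδ') (by
      filter_upwards [hlim] with k hk x
      exact (hk x).trans (le_abs_self _)))
    (by
      filter_upwards [hec, hec', hinvc] with k g₁ g₂ g₃
      exact (hlc k).sub (((g₂.sub g₁).mul (hlc k)).mul g₃))
    (by
      filter_upwards [hec, hec', hinvc] with k g₁ g₂ g₃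
      exact (((g₂.sub g₁).mul (hlc k)).star.mul g₃).neg)
    (by
      filter_upwards [hec, he₀] with k g₁ g₂
      exact ((Complex.continuous_ofReal.comp (hv k)).sub
        (g₁.star.mul (Complex.continuous_ofReal.comp (hw k)))).mul ((g₁.sub g₁.star).inv₀ g₂))
    (by
      filter_upwards [he₀, hvw] with k g₁ g₂ x
      exact eigenCoord_ne_zero (g₁ x) (g₂ x))
  refine ⟨τ, fun k x => eigenCoord (e k x) (v k x) (w k x), η, k₀, ψ, hη, hk₀, h₁, ?_, ?_, h₃⟩
  · convert h₂.add hdiff using 1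
    · ext k x
      simp [hl]
      ring
    · exact (add_zero (0 : K → ℂ)).symm
  · filter_upwards [hwrec, he₁, he₀] with k g₁ g₂ g₃ x
    rw [g₁ x]
    have := sub_star_mul_eigenCoord (v := v k x) (w := w k x) (g₂ x) (g₃ x)
    rw [hl] at this
    exact this

end Elliptic

theorem isSymbol_entry_of_stolzClass {K : Type*} [TopologicalSpace K] [CompactSpace K] {r : ℕ}
    (hr : r ≠ 0) {Y : ℕ → C(K, Matrix (Fin 2) (Fin 2) ℝ)} (hY : StolzClass r 0 Y) (p q : Fin 2) :
    IsSymbol r r 0 (fun k x => (Y k x p q : ℂ)) := by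
  obtain ⟨C, hC₀, hC⟩ : ∃ C : ℝ, 0 ≤ C ∧ ∀ M : Matrix (Fin 2) (Fin 2) ℝ, |M p q| ≤ C * ‖M‖ :=
    ⟨_, norm_nonneg _, (Matrix.entryLinearMap ℝ ℝ p q).toContinuousLinearMap.le_opNorm⟩
  have hnorm (Z : C(K, Matrix (Fin 2) (Fin 2) ℝ)) (x : K) : ‖(Z x p q : ℂ)‖ ≤ C * ‖Z‖ := by
    rw [Complex.norm_real, Real.norm_eq_abs]
    refine (hC _).trans ?_
    gcongr
    exact Z.norm_coe_le_norm x
  have hit (j k : ℕ) (x : K) : (fwdDiff 1)^[j] (fun k (x : K) => (Y k x p q : ℂ)) k x =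
      ((fwdDiff 1)^[j] Y k x p q : ℝ) := by
    induction j generalizing k with
    | zero => rfl
    | succ j ih =>
      rw [Function.iterate_succ_apply', Function.iterate_succ_apply', fwdDiff_one_apply,
        Pi.sub_apply, ih, ih, fwdDiff, ContinuousMap.sub_apply, Matrix.sub_apply,
        Complex.ofReal_sub]
  refine isSymbol_of_iterate fun j hj => ?_
  rcases Nat.eq_zero_or_pos j with rfl | hj₀
  · obtain ⟨c, hc⟩ := hY.1
    refine (decays_zero_iff hr).2 ⟨C * c, ?_⟩
    filter_upwards [eventually_ge_atTop 1] with k hk x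
    refine (hnorm (Y k) x).trans ?_
    gcongr
    exact hc k hk
  · have hsum := hY.2 j hj₀ (by omega)
    have hj' : (j : ℝ) ≠ 0 := by positivity
    -- The weight is the j-th root of the norm: its j-th power is the norm itself, and its r-th
    -- power is the summand with exponent r / j of the Stolz condition.
    refine ⟨C, fun k => ‖(fwdDiff 1)^[j] Y k‖ ^ (j : ℝ)⁻¹, hC₀, fun k => by positivity, ?_, ?_⟩
    · refine (summable_nat_add_iff 1).1 (hsum.congr fun k => ?_)
      rw [← Real.rpow_natCast, ← Real.rpow_mul (norm_nonneg _)]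
      congr 1
      push_cast
      field_simp
      simp
    · refine Eventually.of_forall fun k x => ?_
      rw [hit, zero_add, ← Real.rpow_natCast, ← Real.rpow_mul (norm_nonneg _),
        inv_mul_cancel₀ hj', Real.rpow_one]
      exact hnorm _ x

/-! ### Uniform limits on compact subsets of the elliptic set. -/

section Limits

theorem tendstoUniformly_congr {X : Type*} {F G : ℕ → X → ℂ} {f : X → ℂ}
    (h : TendstoUniformly F f atTop) (hFG : ∀ᶠ k in atTop, ∀ x, F k x = G k x) :
    TendstoUniformly G f atTop := by
  intro u hu
  filter_upwards [h u hu, hFG] with k h₁ h₂ x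
  rw [← h₂ x]
  exact h₁ x

/-- Mere continuity of Φ is enough: on a compact space uniform convergence is convergence in C(X,
Y), where postcomposition is continuous. -/
theorem tendstoUniformly_continuous_comp {X Y Z : Type*} [TopologicalSpace X] [CompactSpace X]
    [PseudoMetricSpace Y] [PseudoMetricSpace Z] {F : ℕ → X → Y} {f : X → Y} {Φ : Y → Z}
    (h : TendstoUniformly F f atTop) (hF : ∀ k, Continuous (F k)) (hf : Continuous f)
    (hΦ : Continuous Φ) : TendstoUniformly (fun k x => Φ (F k x)) (fun x => Φ (f x)) atTop := by
  have h₁ : Tendsto (fun k => (⟨F k, hF k⟩ : C(X, Y))) atTop (𝓝 ⟨f, hf⟩) :=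
    ContinuousMap.tendsto_iff_tendstoUniformly.2 h
  have h₂ := ((ContinuousMap.continuous_postcomp (X := X) ⟨Φ, hΦ⟩).tendsto _).comp h₁
  exact ContinuousMap.tendsto_iff_tendstoUniformly.1 h₂

variable {a b : ℕ → ℝ} {N i : ℕ} {K : Set ℝ} [CompactSpace K]

/-- On a compact subset of the elliptic set the discriminants converge uniformly. -/
theorem exists_uniform_limit_discr (hK : K ⊆ ellipticSet a b N i) :
    ∃ g : K → ℝ, (∀ x, g x < 0) ∧ Continuous g ∧
      TendstoUniformly (fun k (x : K) => discr (transferProd a b N (k * N + i) x)) g atTop := by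
  obtain ⟨g, hgc, hg⟩ := exists_uniform_limit_of_polynomials (K := K) (2 * N)
    (F := fun k x => discr (transferProd a b N (k * N + i) x))
    (fun k => by
      choose P hP hP' using exists_polynomial_transferProd a b N (k * N + i)
      have hmul (p q p' q' : Fin 2) : (P p q * P p' q').natDegree ≤ 2 * N := by
        rw [two_mul]
        exact Polynomial.natDegree_mul_le.trans (add_le_add (hP _ _) (hP _ _))
      refine ⟨P 0 0 * P 0 0 + P 1 1 * P 1 1 - Polynomial.C 2 * (P 0 0 * P 1 1) +
        Polynomial.C 4 * (P 0 1 * P 1 0), ?_, fun x => ?_⟩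
      · have hC (c : ℝ) (p q p' q' : Fin 2) :
            (Polynomial.C c * (P p q * P p' q')).natDegree ≤ 2 * N :=
          (Polynomial.natDegree_C_mul_le _ _).trans (hmul _ _ _ _)
        refine Polynomial.natDegree_add_le_of_degree_le ((Polynomial.natDegree_sub_le_of_le
          (Polynomial.natDegree_add_le_of_degree_le (hmul _ _ _ _) (hmul _ _ _ _))
          (hC _ _ _ _ _)).trans (max_self _).le) (hC _ _ _ _ _)
      · simp [discr, Matrix.trace_fin_two, Matrix.det_fin_two, hP']
        ring)
    (fun x => by
      obtain ⟨l, -, hl⟩ := hK x.2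
      exact ⟨l, hl⟩)
  refine ⟨g, fun x => ?_, hgc, hg⟩
  obtain ⟨l, hl, hl'⟩ := hK x.2
  rwa [tendsto_nhds_unique (hg.tendsto_at x) hl']

theorem eventually_le_neg_of_tendstoUniformly {X : Type*} [TopologicalSpace X] [CompactSpace X]
    {F : ℕ → X → ℝ} {g : X → ℝ} (h : TendstoUniformly F g atTop) (hc : Continuous g)
    (hg : ∀ x, g x < 0) : ∃ δ > 0, ∀ᶠ k in atTop, ∀ x, F k x ≤ -δ := by
  obtain ⟨δ, hδ, hle⟩ : ∃ δ > 0, ∀ x, g x ≤ -δ := by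
    rcases isEmpty_or_nonempty X with hX | hX
    · exact ⟨1, one_pos, fun x => (hX.false x).elim⟩
    · obtain ⟨x₀, -, hx₀⟩ := (isCompact_univ (X := X)).exists_isMaxOn Set.univ_nonempty
        hc.continuousOn
      exact ⟨-g x₀, neg_pos.2 (hg x₀), fun x => by simpa using hx₀ (Set.mem_univ x)⟩
  refine ⟨δ / 2, half_pos hδ, ?_⟩
  filter_upwards [Metric.tendstoUniformly_iff.1 h (δ / 2) (half_pos hδ)] with k hk x
  have := hk x
  rw [dist_comm, Real.dist_eq] at this
  linarith [le_abs_self (F k x - g x), hle x]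

theorem tendsto_det_transferProd (ha : ∀ n, 0 < a n) (hN : 1 ≤ N)
    (hratio : Tendsto (fun k : ℕ => a ((k + 1) * N + i - 1) / a (k * N + i - 1)) atTop (𝓝 1))
    (x : ℝ) : Tendsto (fun k => (transferProd a b N (k * N + i) x).det) atTop (𝓝 1) := by
  have := hratio.inv₀ one_ne_zero
  rw [inv_one] at this
  refine this.congr' ?_
  filter_upwards [eventually_ge_atTop 1] with k hk
  have h₁ : 1 * 1 ≤ k * N := Nat.mul_le_mul hk hN
  rw [det_transferProd ha N (by omega), inv_div, show (k + 1) * N + i = k * N + i + N by ring]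

/-- The square tr² = discr + 4 det converges pointwise and the increments of the trace tend to 0, so
the trace converges pointwise; its bounded degree makes this uniform. -/
theorem exists_uniform_limit_trace (ha : ∀ n, 0 < a n) (hN : 1 ≤ N)
    (hK : K ⊆ ellipticSet a b N i)
    (hratio : Tendsto (fun k : ℕ => a ((k + 1) * N + i - 1) / a (k * N + i - 1)) atTop (𝓝 1))
    {d : ℕ} (hX : ∀ p q, IsSymbol (d + 1) (d + 1) 0
      (fun k (x : K) => (transferProd a b N (k * N + i) x p q : ℂ))) :
    ∃ θ : K → ℝ, Continuous θ ∧
      TendstoUniformly (fun k (x : K) => (transferProd a b N (k * N + i) x).trace) θ atTop := by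
  refine exists_uniform_limit_of_polynomials N (fun k => ?_) fun x => ?_
  · choose P hP hP' using exists_polynomial_transferProd a b N (k * N + i)
    exact ⟨P 0 0 + P 1 1, Polynomial.natDegree_add_le_of_degree_le (hP _ _) (hP _ _),
      fun x => by simp [Matrix.trace_fin_two, hP']⟩
  · obtain ⟨l, -, hl⟩ := hK x.2
    refine exists_tendsto_of_sq (g := l + 4 * 1) ?_ ?_
    · refine (hl.add ((tendsto_det_transferProd (b := b) ha hN hratio x).const_mul 4)).congr
        fun k => ?_
      rw [discr]
      ring
    · have h := (((hX 0 0).add (hX 1 1)).2.decays.tendstoUniformly one_ne_zero).tendsto_at x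
      have h' := (Complex.continuous_re.tendsto _).comp h
      refine h'.congr fun k => ?_
      simp [Matrix.trace_fin_two, fwdDiff_one_apply]

end Limits

/-- Asymptotics of the orthonormal polynomials on a compact subset of the elliptic set; the limit
function has no zeros. -/
theorem exists_asymptotics (a b : ℕ → ℝ) (ha : ∀ n, 0 < a n) (N r i : ℕ) (hN : 1 ≤ N)
    (hr : 1 ≤ r) (K : Set ℝ) [CompactSpace K] (hK : K ⊆ ellipticSet a b N i)
    (hratio : Tendsto (fun k : ℕ => a ((k + 1) * N + i - 1) / a (k * N + i - 1)) atTop (𝓝 1))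
    (hX : StolzClass r 0 (fun k : ℕ => transferProdOn a b N K (k * N + i))) :
    ∃ (t : ℕ → C(K, ℂ)) (φ : C(K, ℂ)),
      (∀ x, φ x ≠ 0) ∧
      (∃ δ : ℝ, 0 < δ ∧ ∀ j x, δ ≤ ‖t j x‖) ∧
      TendstoUniformly
        (fun (k : ℕ) (x : K) =>
          ((orthoPoly a b ((k + 1) * N + i) x : ℂ)
              - starRingEnd ℂ (eigen a b N (k * N + i) x) * (orthoPoly a b (k * N + i) x : ℂ))
            * ∏ j ∈ Finset.Icc 1 k, (t j x)⁻¹)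
        (fun x : K => φ x) atTop ∧
      TendstoUniformly (fun (j : ℕ) (x : K) => t j x - eigen a b N (j * N + i) x)
        (fun _ : K => 0) atTop := by
  obtain ⟨d, rfl⟩ : ∃ d, r = d + 1 := ⟨r - 1, by omega⟩
  have hsym (p q : Fin 2) : IsSymbol (d + 1) (d + 1) 0
      (fun k (x : K) => (transferProd a b N (k * N + i) x p q : ℂ)) :=
    isSymbol_entry_of_stolzClass d.succ_ne_zero hX p q
  obtain ⟨g, hg, hgc, hdis⟩ := exists_uniform_limit_discr hK
  obtain ⟨θ, hθc, hθ⟩ := exists_uniform_limit_trace ha hN hK hratio hsym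
  obtain ⟨δ, hδ, hdδ⟩ := eventually_le_neg_of_tendstoUniformly hdis hgc hg
  obtain ⟨l, hl⟩ : ∃ l : ℕ → K → ℂ, 
      l = fun k (x : K) => upperEigenvalue (transferProd a b N (k * N + i) x) := ⟨_, rfl⟩
  obtain ⟨L, hL⟩ : ∃ L : K → ℂ, L = fun x => (θ x : ℂ) / 2 + Complex.I / 2 * (√|g x| : ℂ) :=
    ⟨_, rfl⟩
  have hLc : Continuous L := by
    rw [hL]
    fun_prop
  have hlL : TendstoUniformly l L atTop := by
    have hXc (k : ℕ) : Continuous fun x : K => transferProd a b N (k * N + i) x :=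
      (continuous_transferProd a b N _).comp continuous_subtype_val
    have h₁ := tendstoUniformly_continuous_comp (f := θ) hθ
      (fun k => (hXc k).matrix_trace) hθc (Φ := fun y => (y : ℂ) / 2) (by fun_prop)
    have h₂ := tendstoUniformly_continuous_comp (f := g) hdis
      (fun k => ((hXc k).matrix_trace.pow 2).sub (continuous_const.mul (hXc k).matrix_det)) hgc
      (Φ := fun y => Complex.I / 2 * (√|y| : ℂ)) (by fun_prop)
    rw [hl, hL]
    exact h₁.add h₂
  -- Here |λ_n|² = det X_n, which tends to 1; hence `L` can be inverted.
  have hLn (x : K) : ‖L x‖ = 1 := by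
    have h₁ := ((hlL.tendsto_at x).norm.pow 2)
    have h₂ : Tendsto (fun k => ‖l k x‖ ^ 2) atTop (𝓝 1) := by
      refine (tendsto_det_transferProd (b := b) ha hN hratio x).congr' ?_
      filter_upwards [hdδ] with k hk
      rw [hl, norm_upperEigenvalue_sq (by linarith [hk x])]
    exact (pow_eq_one_iff_of_nonneg (norm_nonneg _) two_ne_zero).1 (tendsto_nhds_unique h₁ h₂)
  have hL₀ (x : K) : L x ≠ 0 := norm_pos_iff.1 (by rw [hLn]; exact one_pos)
  have hLi (x : K) : L x - star (L x) ≠ 0 := by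
    rw [← norm_pos_iff, norm_sub_star, hL]
    have : 0 < √|g x| := Real.sqrt_pos.2 (abs_pos.2 (hg x).ne)
    simpa using this.ne'
  have hrec (k : ℕ) (hk : 1 ≤ k) (x : ℝ) := by
    -- For k ≥ 1 the index kN + i is positive, so the truncated subtraction in kN + i - 1 is
    -- genuine.
    have h₁ : 1 * 1 ≤ k * N := Nat.mul_le_mul hk hN
    have := transferProd_mulVec (b := b) ha N (n := k * N + i) (by omega) x
    rwa [show k * N + i + N = (k + 1) * N + i by ring] at this
  obtain ⟨τ, z, η, k₀, ψ, hη, hk₀, hτ, hτl, hz, hψ, hψc, hψ₀⟩ :=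
    exists_multipliers_of_elliptic (K := K) d.succ_ne_zero hsym
      (v := fun k x => orthoPoly a b (k * N + i - 1) x)
      (w := fun k x => orthoPoly a b (k * N + i) x)
      (fun k => (continuous_transferProd a b N _).comp continuous_subtype_val)
      (fun k => (continuous_orthoPoly _).comp continuous_subtype_val)
      (fun k => (continuous_orthoPoly _).comp continuous_subtype_val)
      (by
        filter_upwards [eventually_ge_atTop 1] with k hk x
        have := congrFun (hrec k hk x) 0
        simpa [Matrix.mulVec, dotProduct, Fin.sum_univ_two] using this.symm)
      (by
        filter_upwards [eventually_ge_atTop 1] with k hk x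
        have := congrFun (hrec k hk x) 1
        simpa [Matrix.mulVec, dotProduct, Fin.sum_univ_two] using this.symm)
      (by
        filter_upwards [eventually_ge_atTop 1] with k hk x
        have h₁ : 1 * 1 ≤ k * N := Nat.mul_le_mul hk hN
        have := orthoPoly_ne_zero_or (b := b) ha (k * N + i - 1) x
        rwa [Nat.sub_add_cancel (by omega)] at this)
      hδ hdδ
  have hτL : TendstoUniformly τ L atTop := by
    convert hτl.add hlL using 1
    · ext k x
      simp [hl]
    · exact (zero_add L).symm
  -- Below `k₀` the value 1 leaves the product unchanged and respects the lower bound.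
  let t : ℕ → C(K, ℂ) := fun k => if h : k₀ ≤ k then ⟨τ k, (hτ k h).1⟩ else 1
  have ht (k : ℕ) (hk : k₀ ≤ k) (x : K) : t k x = τ k x := by simp [t, hk]
  have ht' (k : ℕ) (hk : ¬ k₀ ≤ k) (x : K) : t k x = 1 := by simp [t, hk]
  -- The stated product includes the factor j = k, whereas z_k is normalised by the factors j < k;
  -- the extra 1 / τ_k converges uniformly to 1 / L.
  have hprod (k : ℕ) (hk : k₀ ≤ k) (x : K) : ∏ j ∈ Finset.Icc 1 k, (t j x)⁻¹ =
      (∏ j ∈ Finset.Ico k₀ k, (τ j x)⁻¹) * (τ k x)⁻¹ := by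
    rw [← Finset.prod_Ico_succ_top hk]
    symm
    calc ∏ j ∈ Finset.Ico k₀ (k + 1), (τ j x)⁻¹ = ∏ j ∈ Finset.Ico k₀ (k + 1), (t j x)⁻¹ :=
          Finset.prod_congr rfl fun j hj => by rw [ht j (Finset.mem_Ico.1 hj).1]
      _ = ∏ j ∈ Finset.Icc 1 k, (t j x)⁻¹ := by
          refine Finset.prod_subset (fun j hj => ?_) fun j hj hj' => ?_
          · rw [Finset.mem_Ico] at hj
            rw [Finset.mem_Icc]
            omega
          · rw [Finset.mem_Icc] at hj
            rw [Finset.mem_Ico] at hj'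
            rw [ht' j (by omega), inv_one]
  have hmain : TendstoUniformly (fun k x => (l k x - star (l k x)) * (τ k x)⁻¹ *
      (z k x * ∏ j ∈ Finset.Ico k₀ k, (τ j x)⁻¹))
      (fun x => (L x - star (L x)) * (L x)⁻¹ * ψ x) atTop := by
    have h₁ : TendstoUniformly (fun k x => l k x - star (l k x)) (fun x => L x - star (L x))
        atTop :=
      hlL.sub (Complex.isometry_conj.uniformContinuous.comp_tendstoUniformly hlL)
    have h₂ := (hτL.tendstoLocallyUniformly.inv₀ hLc hL₀)
    exact tendstoLocallyUniformly_iff_tendstoUniformly_of_compactSpace.1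
      ((h₁.tendstoLocallyUniformly.mul₀ h₂ (hLc.sub hLc.star) (hLc.inv₀ hL₀)).mul₀
        hψ.tendstoLocallyUniformly ((hLc.sub hLc.star).mul (hLc.inv₀ hL₀)) hψc)
  refine ⟨t, ⟨fun x => (L x - star (L x)) * (L x)⁻¹ * ψ x,
    ((hLc.sub hLc.star).mul (hLc.inv₀ hL₀)).mul hψc⟩,
    fun x => mul_ne_zero (mul_ne_zero (hLi x) (inv_ne_zero (hL₀ x))) (hψ₀ x),
    ⟨min η 1, by positivity, fun j x => ?_⟩, ?_, ?_⟩
  · by_cases h : k₀ ≤ j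
    · rw [ht j h]
      exact (min_le_left _ _).trans ((hτ j h).2 x)
    · rw [ht' j h, norm_one]
      exact min_le_right _ _
  · refine tendstoUniformly_congr hmain ?_
    filter_upwards [hz, eventually_ge_atTop k₀] with k h₁ h₂ x
    rw [hprod k h₂ x]
    have h₃ : (orthoPoly a b ((k + 1) * N + i) x : ℂ) - starRingEnd ℂ
        (eigen a b N (k * N + i) x) * (orthoPoly a b (k * N + i) x : ℂ) =
        (l k x - star (l k x)) * z k x := by
      rw [hl]
      exact h₁ x
    rw [h₃]
    ring
  · refine tendstoUniformly_congr hτl ?_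
    filter_upwards [eventually_ge_atTop k₀] with k hk x
    rw [ht k hk]
    rfl

end JacobiStolz

theorem theorem2 (a b : ℕ → ℝ) (ha : ∀ n, 0 < a n)
    (N r i : ℕ) (hN : 1 ≤ N) (hr : 1 ≤ r) (hi : i < N)
    (K : Set ℝ) [CompactSpace K] (hK : K ⊆ JacobiStolz.ellipticSet a b N i)
    (hratio : Tendsto (fun k : ℕ => a ((k + 1) * N + i - 1) / a (k * N + i - 1)) atTop (𝓝 1))
    (hX : JacobiStolz.StolzClass r 0
      (fun k : ℕ => JacobiStolz.transferProdOn a b N K (k * N + i))) :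
    ∃ (t : ℕ → C(K, ℂ)) (φ : C(K, ℂ)),
      (∃ δ : ℝ, 0 < δ ∧ ∀ j : ℕ, 1 ≤ j → ∀ x : K, δ ≤ ‖t j x‖) ∧
      TendstoUniformly
        (fun (k : ℕ) (x : K) =>
          ((JacobiStolz.orthoPoly a b ((k + 1) * N + i) x : ℂ)
              - starRingEnd ℂ (JacobiStolz.eigen a b N (k * N + i) x)
                * (JacobiStolz.orthoPoly a b (k * N + i) x : ℂ))
            * ∏ j ∈ Finset.Icc 1 k, (t j x)⁻¹)
        (fun x : K => φ x) atTop ∧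
      TendstoUniformly
        (fun (j : ℕ) (x : K) => t j x - JacobiStolz.eigen a b N (j * N + i) x)
        (fun _ : K => 0) atTop := by
  obtain ⟨t, φ, -, ⟨δ, hδ, ht⟩, h⟩ :=
    JacobiStolz.exists_asymptotics a b ha N r i hN hr K hK hratio hX
  exact ⟨t, φ, ⟨δ, hδ, fun j _ x => ht j x⟩, h⟩
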